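/- **Conventions.** Rings are associative, not necessarily unital; unital rings satisfy $1\neq 0$. For a subring $S$ of a ring $R$, the extension $R/S$ is *separable* if the multiplication map $\mu:R\otimes_S R\to R$, $r\otimes r'\mapsto rr'$, has a section $\delta:R\to R\otimes_S R$ ($\mu\circ\delta=\mathrm{id}_R$) that is a homomorphism of $R$-bimodules. Let $\Gamma$ be a groupoid with object set $\Gamma_0$, and let $d(\sigma)$, $r(\sigma)$ be the domain and range of a morphism $\sigma$; $\sigma\tau$ is defined if $d(\sigma)=r(\tau)$. Write $\Gamma(e,f)$ for the set of morphisms $e\to f$ and $\Gamma(e)=\Gamma(e,e)$. Assume that $\Gamma$ is connected: $\Gamma(e,f)\ne\emptyset$ for all $e,f\in\Gamma_0$. An *object crossed system* $(A,\Gamma,\alpha,\beta)$ consists of unital rings $A_e$ ($e\in\Gamma_0$), unital ring isomorphisms $\alpha_\sigma:A_{d(\sigma)}\to A_{r(\sigma)}$ ($\sigma\in\Gamma$) and units $\beta_{\sigma,\tau}$ of $A_{r(\sigma)}$ ($d(\sigma)=r(\tau)$) such that $\alpha_e=\mathrm{id}_{A_e}$; $\beta_{\sigma,d(\sigma)}=\beta_{r(\sigma),\sigma}=1$;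 $\alpha_\sigma(\alpha_\tau(a))=\beta_{\sigma,\tau}\alpha_{\sigma\tau}(a)\beta_{\sigma,\tau}^{-1}$; and $\beta_{\sigma,\tau}\beta_{\sigma\tau,\rho}=\alpha_\sigma(\beta_{\tau,\rho})\beta_{\sigma,\tau\rho}$, for all composable $\sigma,\tau$ (resp. $\sigma,\tau,\rho$) and $a\in A_{d(\tau)}$. (Objects are identified with their identity morphisms.) The *object crossed product* $R=A\rtimes^\alpha_\beta\Gamma$ is the ring of finite formal sums $\sum_{\sigma\in\Gamma}a_\sigma u_\sigma$, $a_\sigma\in A_{r(\sigma)}$, with biadditive product given by $(a u_\sigma)(b u_\tau)=a\,\alpha_\sigma(b)\,\beta_{\sigma,\tau}\,u_{\sigma\tau}$ if $d(\sigma)=r(\tau)$, and $0$ otherwise. If all $A_e$ are the same ring $B$ and all $\alpha_\sigma$ are $\mathrm{id}_B$, then $R$ is called an *object twisted groupoid ring* and is written $B\rtimes_\beta\Gamma$. Let $\Delta$ be a wide subgroupoid of $\Gamma$ (that is, $\Delta_0=\Gamma_0$), and put $\Delta(e)=\Delta\cap\Gamma(e)$ and $R_\Delta=\bigoplus_{\sigma\in\Delta}A_{r(\sigma)}u_\sigma\subseteq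 R$, the object crossed product of the restricted system. Call $\Delta$ *normal* if $\sigma\Delta(e)\sigma^{-1}\subseteq\Delta(f)$ for all $\sigma\in\Gamma(e,f)$. Let $\Lambda=\bigcup_{e\in\Gamma_0}\Delta(e)$, let $T$ be a set of representatives for the equivalence relation $\sigma\Lambda=\tau\Lambda$ on $\Gamma$, and let $T_{f,e}=T\cap\Gamma(f,e)$. Put $\Gamma_0^{\rm fin}=\{f\in\Gamma_0 : [\Gamma(f):\Delta(f)]<\infty\}$ and $Z(A_e)^{\Delta(e)}=\{a\in Z(A_e) : \alpha_\sigma(a)=a\text{ for all }\sigma\in\Delta(e)\}$. For $e\in\Gamma_0$, $f\in\Gamma_0^{\rm fin}$ and $a\in Z(A_f)^{\Delta(f)}$ let $$\mathrm{tr}^{f,e}_{\Gamma/\Delta}(a)=\sum_{\tau\in T_{f,e}}\alpha_\tau(a)\in A_e ,$$ which is a finite sum. **Theorem.** With the above notation: (a) $R/R_\Delta$ is separable if and only if, for each $e\in\Gamma_0$, there exist a finite subset $F_e$ of $\Gamma_0^{\rm fin}$ and elements $a^e_f\in Z(A_f)^{\Delta(f)}$, $f\in F_e$, with $\sum_{f\in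 F_e}\mathrm{tr}^{f,e}_{\Gamma/\Delta}(a^e_f)=1_{A_e}$. (b) If there are $f\in\Gamma_0$ and $a\in Z(A_f)^{\Delta(f)}$ such that $[\Gamma(f):\Delta(f)]<\infty$ and $\mathrm{tr}^{f,f}_{\Gamma/\Delta}(a)=1_{A_f}$, then $R/R_\Delta$ is separable. (c) If $\Delta$ is normal, then $R/R_\Delta$ is separable if and only if, for each $e\in\Gamma_0$, $[\Gamma(e):\Delta(e)]<\infty$ and there is $a\in Z(A_e)^{\Delta(e)}$ with $\mathrm{tr}^{e,e}_{\Gamma/\Delta}(a)=1_{A_e}$. (d) If $R=B\rtimes_\beta\Gamma$ is an object twisted groupoid ring, then $R/R_\Delta$ is separable if and only if, for each $e\in\Gamma_0$, there exist a finite subset $F_e$ of $\Gamma_0^{\rm fin}$ and elements $b^e_f\in Z(B)$, $f\in F_e$, such that $\sum_{f\in F_e}[\Gamma(f):\Delta(f)]\,b^e_f=1_B$. (e) If $\Delta$ is normal and $R=B\rtimes_\beta\Gamma$ is an object twisted groupoid ring, then $R/R_\Delta$ is separable if and only if, for each $e\in\Gamma_0$, $[\Gamma(e):\Delta(e)]$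 is finite and invertible in $B$. (f) If $R=B\rtimes_\beta\Gamma$ is an object twisted groupoid ring and there is $f\in\Gamma_0$ such that $[\Gamma(f):\Delta(f)]$ is finite and invertible in $B$, then $R/R_\Delta$ is separable. -/

import Mathlib

open CategoryTheory
open scoped TensorProduct DirectSum

universe w v u

noncomputable section

/-! Separable extensions of (not necessarily unital) rings. -/

namespace RingExt

variable {R : Type*} [NonUnitalRing R]

/-- The additive subgroup of `R ⊗[ℤ] R` generated by all `r s ⊗ r' - r ⊗ s r'` with `s ∈ S`. -/
def balancing (S : NonUnitalSubring R) : AddSubgroup (R ⊗[ℤ] R) :=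
  AddSubgroup.closure
    {z | ∃ r : R, ∃ s ∈ S, ∃ r' : R, z = (r * s) ⊗ₜ[ℤ] r' - r ⊗ₜ[ℤ] (s * r')}

/-- The tensor product `R ⊗_S R` of a ring extension `R/S`, as an additive group. -/
abbrev RelTensor (S : NonUnitalSubring R) : Type _ := (R ⊗[ℤ] R) ⧸ balancing S

variable (S : NonUnitalSubring R)

/-- The left action of `R` on `R ⊗_S R`: `a (r ⊗ r') = (a r) ⊗ r'`. -/
def leftAct (a : R) : RelTensor S →+ RelTensor S :=
  QuotientAddGroup.map (balancing S) (balancing S)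
    (TensorProduct.map (LinearMap.mulLeft ℤ a) LinearMap.id).toAddMonoidHom <| by
      rw [balancing, AddSubgroup.closure_le]
      rintro _ ⟨r, s, hs, r', rfl⟩
      refine AddSubgroup.subset_closure ⟨a * r, s, hs, r', ?_⟩
      rw [map_sub]
      simp only [LinearMap.toAddMonoidHom_coe, TensorProduct.map_tmul, LinearMap.mulLeft_apply,
        LinearMap.id_apply, mul_assoc]

/-- The right action of `R` on `R ⊗_S R`: `(r ⊗ r') a = r ⊗ (r' a)`. -/
def rightAct (a : R) : RelTensor S →+ RelTensor S :=
  QuotientAddGroup.map (balancing S) (balancing S)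
    (TensorProduct.map LinearMap.id (LinearMap.mulRight ℤ a)).toAddMonoidHom <| by
      rw [balancing, AddSubgroup.closure_le]
      rintro _ ⟨r, s, hs, r', rfl⟩
      refine AddSubgroup.subset_closure ⟨r, s, hs, r' * a, ?_⟩
      rw [map_sub]
      simp only [LinearMap.toAddMonoidHom_coe, TensorProduct.map_tmul, LinearMap.mulRight_apply,
        LinearMap.id_apply, mul_assoc]

/-- The multiplication map `R ⊗_S R → R`, `r ⊗ r' ↦ r r'`. -/
def mulMap : RelTensor S →+ R :=
  QuotientAddGroup.lift (balancing S) (LinearMap.mul' ℤ R).toAddMonoidHom <| by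
    rw [balancing, AddSubgroup.closure_le]
    rintro _ ⟨r, s, hs, r', rfl⟩
    rw [SetLike.mem_coe, AddMonoidHom.mem_ker, map_sub]
    simp only [LinearMap.toAddMonoidHom_coe, LinearMap.mul'_apply, mul_assoc, sub_self]

/-- `R/S` is separable: the multiplication map `R ⊗_S R → R` has a section which is a
homomorphism of `R`-bimodules. -/
def IsSeparable : Prop :=
  ∃ δ : R →+ RelTensor S,
    (∀ a x : R, δ (a * x) = leftAct S a (δ x)) ∧
    (∀ x a : R, δ (x * a) = rightAct S a (δ x)) ∧
    ∀ x : R, mulMap S (δ x) = x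

end RingExt

/-! Object crossed products. In the category-theoretic notation of Mathlib the composite
`στ` (first `τ`, then `σ`) is written `τ ≫ σ`. -/

/-- An object crossed system `(A, Γ, α, β)`. -/
structure ObjectCrossedSystem (Γ : Type u) [Groupoid.{v} Γ] (A : Γ → Type w)
    [∀ e, Ring (A e)] where
  /-- the ring isomorphisms `α_σ : A_{d(σ)} → A_{r(σ)}` -/
  α : ∀ {e f : Γ}, (e ⟶ f) → (A e ≃+* A f)
  /-- the units `β_{σ,τ}` of `A_{r(σ)}`, where `d(σ) = r(τ)` -/
  β : ∀ {e f g : Γ}, (f ⟶ g) → (e ⟶ f) → (A g)ˣ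
  α_id : ∀ (e : Γ) (a : A e), α (𝟙 e) a = a
  β_id_right : ∀ {e f : Γ} (σ : e ⟶ f), β σ (𝟙 e) = 1
  β_id_left : ∀ {e f : Γ} (σ : e ⟶ f), β (𝟙 f) σ = 1
  α_comp : ∀ {e f g : Γ} (σ : f ⟶ g) (τ : e ⟶ f) (a : A e),
    α σ (α τ a) = (β σ τ : A g) * α (τ ≫ σ) a * ((β σ τ)⁻¹ : (A g)ˣ)
  β_cocycle : ∀ {e f g h : Γ} (σ : g ⟶ h) (τ : f ⟶ g) (ρ : e ⟶ f),
    (β σ τ : A h) * (β (τ ≫ σ) ρ : A h) = α σ (β τ ρ : A g) * (β σ (ρ ≫ τ) : A h)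

/-- The morphisms of `Γ`; for `σ : Arr Γ`, `σ.1` is the domain and `σ.2.1` is the range. -/
abbrev Arr (Γ : Type u) [Groupoid.{v} Γ] : Type (max u v) := Σ e f : Γ, (e ⟶ f)

namespace ObjectCrossedSystem

variable {Γ : Type u} [Groupoid.{v} Γ] {A : Γ → Type w} [∀ e, Ring (A e)]

/-- The additive group of formal sums `∑ a_σ u_σ` with `a_σ ∈ A_{r(σ)}`, almost all zero. -/
def CrossedProduct (_S : ObjectCrossedSystem Γ A) : Type (max w v u) :=
  ⨁ σ : Arr Γ, A σ.2.1

variable (S : ObjectCrossedSystem Γ A)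

namespace CrossedProduct

instance : AddCommGroup S.CrossedProduct :=
  inferInstanceAs (AddCommGroup (⨁ σ : Arr Γ, A σ.2.1))

/-- The coefficient `a_σ` of a formal sum. -/
def coeff (σ : Arr Γ) : S.CrossedProduct →+ A σ.2.1 :=
  DFinsupp.evalAddMonoidHom (β := fun σ : Arr Γ => A σ.2.1) σ

open scoped Classical in
/-- The monomial `a u_σ`. -/
def mono (σ : Arr Γ) : A σ.2.1 →+ S.CrossedProduct :=
  DirectSum.of (fun σ : Arr Γ => A σ.2.1) σ

open scoped Classical in
/-- The additive extension of a family of additive maps defined on monomials. -/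
def lift {M : Type*} [AddCommMonoid M] (φ : ∀ σ : Arr Γ, A σ.2.1 →+ M) : S.CrossedProduct →+ M :=
  DirectSum.toAddMonoid φ

theorem lift_mono {M : Type*} [AddCommMonoid M] (φ : ∀ σ : Arr Γ, A σ.2.1 →+ M) (σ : Arr Γ)
    (a : A σ.2.1) : lift S φ (mono S σ a) = φ σ a := by
  classical
  exact DirectSum.toAddMonoid_of φ σ a

/-- The product `(a u_σ) (b u_τ) = a α_σ(b) β_{σ,τ} u_{στ}` for composable `σ`, `τ`. -/
def mulComposable {e f g : Γ} (σ : f ⟶ g) (τ : e ⟶ f) : A g →+ A f →+ S.CrossedProduct :=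
  AddMonoidHom.mk' (fun a => AddMonoidHom.mk'
      (fun b => mono S ⟨e, g, τ ≫ σ⟩ (a * S.α σ b * (S.β σ τ : A g)))
      (fun b b' => by rw [map_add, mul_add, add_mul, map_add]))
    (fun a a' => by
      ext b
      simp only [AddMonoidHom.mk'_apply, AddMonoidHom.add_apply]
      rw [add_mul, add_mul, map_add])

open scoped Classical in
/-- The product of monomials: as above if `d(σ) = r(τ)`, and zero otherwise. -/
def mulMono (σ τ : Arr Γ) : A σ.2.1 →+ A τ.2.1 →+ S.CrossedProduct :=
  if h : τ.2.1 = σ.1 then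
    match σ, τ, h with
    | ⟨_, _, s⟩, ⟨_, _, t⟩, rfl => mulComposable S s t
  else 0

/-- The biadditive extension of the product of monomials. -/
def mulHom : S.CrossedProduct →+ S.CrossedProduct →+ S.CrossedProduct :=
  lift S fun σ => (lift S fun τ => (mulMono S σ τ).flip).flip

instance : Mul S.CrossedProduct := ⟨fun x y => mulHom S x y⟩

theorem mul_def (x y : S.CrossedProduct) : x * y = mulHom S x y := rfl

theorem mono_mul_mono (σ τ : Arr Γ) (a : A σ.2.1) (b : A τ.2.1) :
    mono S σ a * mono S τ b = mulMono S σ τ a b := by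
  rw [mul_def, mulHom, lift_mono, AddMonoidHom.flip_apply, lift_mono, AddMonoidHom.flip_apply]

theorem mono_mul_mono_comp {e f g : Γ} (σ : f ⟶ g) (τ : e ⟶ f) (a : A g) (b : A f) :
    mono S ⟨f, g, σ⟩ a * mono S ⟨e, f, τ⟩ b =
      mono S ⟨e, g, τ ≫ σ⟩ (a * S.α σ b * (S.β σ τ : A g)) := by
  rw [mono_mul_mono, mulMono, dif_pos rfl]
  rfl

theorem mono_mul_mono_zero (σ τ : Arr Γ) (h : τ.2.1 ≠ σ.1) (a : A σ.2.1) (b : A τ.2.1) :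
    mono S σ a * mono S τ b = 0 := by
  rw [mono_mul_mono, mulMono, dif_neg h]
  rfl

theorem mul_add' (x y z : S.CrossedProduct) : x * (y + z) = x * y + x * z := by
  simp only [mul_def, map_add]

theorem add_mul' (x y z : S.CrossedProduct) : (x + y) * z = x * z + y * z := by
  simp only [mul_def, map_add, AddMonoidHom.add_apply]

theorem zero_mul' (x : S.CrossedProduct) : 0 * x = 0 := by
  simp only [mul_def, map_zero, AddMonoidHom.zero_apply]

theorem mul_zero' (x : S.CrossedProduct) : x * 0 = 0 := by
  simp only [mul_def, map_zero]

theorem induction {p : S.CrossedProduct → Prop} (x : S.CrossedProduct) (h0 : p 0)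
    (h1 : ∀ σ a, p (mono S σ a)) (h2 : ∀ x y, p x → p y → p (x + y)) : p x := by
  classical
  exact DirectSum.induction_on (β := fun σ : Arr Γ => A σ.2.1) x h0 h1 h2

theorem mono_mul_assoc (σ τ ρ : Arr Γ) (a : A σ.2.1) (b : A τ.2.1) (c : A ρ.2.1) :
    mono S σ a * mono S τ b * mono S ρ c = mono S σ a * (mono S τ b * mono S ρ c) := by
  obtain ⟨f, g, s⟩ := σ
  obtain ⟨e, f', t⟩ := τ
  obtain ⟨d, e', r⟩ := ρ
  by_cases h1 : f' = f
  · subst h1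
    by_cases h2 : e' = e
    · subst h2
      rw [mono_mul_mono_comp, mono_mul_mono_comp, mono_mul_mono_comp, mono_mul_mono_comp,
        Category.assoc]
      congr 1
      dsimp only at a b c ⊢
      have hc := S.β_cocycle s t r
      have ha := S.α_comp s t c
      rw [map_mul, map_mul, ha]
      calc a * S.α s b * (S.β s t : A g) * S.α (t ≫ s) c * (S.β (t ≫ s) r : A g)
          = a * S.α s b * ((S.β s t : A g) * S.α (t ≫ s) c) *
              (((S.β s t)⁻¹ : (A g)ˣ) * (S.β s t : A g)) * (S.β (t ≫ s) r : A g) := by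
            rw [Units.inv_mul, mul_one]; simp only [mul_assoc]
        _ = a * S.α s b * ((S.β s t : A g) * S.α (t ≫ s) c) *
              ((S.β s t)⁻¹ : (A g)ˣ) * ((S.β s t : A g) * (S.β (t ≫ s) r : A g)) := by
            simp only [mul_assoc]
        _ = _ := by rw [hc]; simp only [mul_assoc]
    · rw [mono_mul_mono_comp, mono_mul_mono_zero S ⟨e, g, _⟩ ⟨d, e', r⟩ h2,
        mono_mul_mono_zero S ⟨e, f', t⟩ ⟨d, e', r⟩ h2, mul_zero']
  · rw [mono_mul_mono_zero S ⟨f, g, s⟩ ⟨e, f', t⟩ h1, zero_mul']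
    by_cases h2 : e' = e
    · subst h2
      rw [mono_mul_mono_comp, mono_mul_mono_zero S ⟨f, g, s⟩ ⟨d, f', _⟩ h1]
    · rw [mono_mul_mono_zero S ⟨e, f', t⟩ ⟨d, e', r⟩ h2, mul_zero']

/-- The object crossed product `A ⋊^α_β Γ` is an associative ring (in general without unit). -/
instance : NonUnitalRing S.CrossedProduct where
  left_distrib := mul_add' S
  right_distrib := add_mul' S
  zero_mul := zero_mul' S
  mul_zero := mul_zero' S
  mul_assoc x y z := by
    refine induction S (p := fun x => x * y * z = x * (y * z)) x (by rw [zero_mul', zero_mul', zero_mul']) (fun σ a => ?_)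
      (fun x x' h h' => by rw [add_mul', add_mul', add_mul', h, h'])
    refine induction S (p := fun y => mono S σ a * y * z = mono S σ a * (y * z)) y (by rw [zero_mul', mul_zero', zero_mul']) (fun τ b => ?_)
      (fun x x' h h' => by rw [add_mul', mul_add', add_mul', mul_add', h, h'])
    refine induction S (p := fun z => mono S σ a * mono S τ b * z = mono S σ a * (mono S τ b * z)) z (by rw [mul_zero', mul_zero', mul_zero']) (fun ρ c => ?_)
      (fun x x' h h' => by rw [mul_add', mul_add', mul_add', h, h'])
    exact mono_mul_assoc S σ τ ρ a b c

end CrossedProduct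

open CrossedProduct

theorem coeff_mono_ne {σ τ : Arr Γ} (h : τ ≠ σ) (a : A τ.2.1) :
    coeff S σ (mono S τ a) = 0 := by
  classical
  exact DFinsupp.single_eq_of_ne (β := fun σ : Arr Γ => A σ.2.1) h.symm

/-- A formal sum supported in `Δ` is a sum of monomials `a u_σ` with `σ ∈ Δ`. -/
theorem mem_closure_mono (Δ : Subgroupoid Γ) (x : S.CrossedProduct)
    (hx : ∀ σ : Arr Γ, σ ∉ Δ → coeff S σ x = 0) :
    x ∈ AddSubmonoid.closure {y | ∃ σ ∈ Δ, ∃ a, y = mono S σ a} := by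
  classical
  have h : x = ∑ σ ∈ DFinsupp.support (β := fun σ : Arr Γ => A σ.2.1) x,
      mono S σ (coeff S σ x) :=
    (DFinsupp.sum_single (β := fun σ : Arr Γ => A σ.2.1) (f := x)).symm
  rw [h]
  refine AddSubmonoid.sum_mem _ fun σ _ => ?_
  by_cases hσ : σ ∈ Δ
  · exact AddSubmonoid.subset_closure ⟨σ, hσ, _, rfl⟩
  · rw [hx σ hσ, map_zero]
    exact zero_mem _

/-- The subring `R_Δ = ⨁_{σ ∈ Δ} A_{r(σ)} u_σ` of `R = A ⋊^α_β Γ`, that is, the object crossed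
product of the restriction of `(A, Γ, α, β)` to the subgroupoid `Δ`. -/
def subring (Δ : Subgroupoid Γ) : NonUnitalSubring S.CrossedProduct where
  carrier := {x | ∀ σ : Arr Γ, σ ∉ Δ → coeff S σ x = 0}
  zero_mem' := fun σ _ => map_zero _
  add_mem' := fun hx hy σ hσ => by rw [map_add, hx σ hσ, hy σ hσ, add_zero]
  neg_mem' := fun hx σ hσ => by rw [map_neg, hx σ hσ, neg_zero]
  mul_mem' := fun {x y} hx hy ρ hρ => by
    have hx' := mem_closure_mono S Δ x hx
    have hy' := mem_closure_mono S Δ y hy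
    clear hx hy
    induction hx' using AddSubmonoid.closure_induction with
    | zero => rw [zero_mul, map_zero]
    | add x x' _ _ h h' => rw [add_mul, map_add, h, h', add_zero]
    | mem x h =>
      obtain ⟨σ, hσ, a, rfl⟩ := h
      induction hy' using AddSubmonoid.closure_induction with
      | zero => rw [mul_zero, map_zero]
      | add x x' _ _ h h' => rw [mul_add, map_add, h, h', add_zero]
      | mem y h =>
        obtain ⟨τ, hτ, b, rfl⟩ := h
        obtain ⟨f, g, s⟩ := σ
        obtain ⟨e, f', t⟩ := τ
        by_cases hf : f' = f
        · subst hf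
          rw [mono_mul_mono_comp]
          refine coeff_mono_ne S ?_ _
          rintro rfl
          exact hρ (Δ.mul hτ hσ)
        · rw [mono_mul_mono_zero S ⟨f, g, s⟩ ⟨e, f', t⟩ hf, map_zero]

/-- `Z(A_e)^{Δ(e)}`: the central elements of `A_e` fixed by `α_σ` for all `σ ∈ Δ(e)`. -/
def fixedCenter (Δ : Subgroupoid Γ) (e : Γ) : Set (A e) :=
  {a | a ∈ Subring.center (A e) ∧ ∀ σ ∈ Δ.arrows e e, S.α σ a = a}

/-- The relative trace `tr^{f,e}(a) = ∑_{τ ∈ T_{f,e}} α_τ(a)`, where `T` is a family of sets of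
representatives (it is only used when `T_{f,e}` is finite). -/
def relTrace (T : ∀ f e : Γ, Set (f ⟶ e)) (f e : Γ) (a : A f) : A e :=
  ∑ᶠ τ ∈ T f e, S.α τ a

/-- An object twisted groupoid ring `B ⋊_β Γ`: all `A_e` are the same ring `B` and all `α_σ` are
the identity map of `B`. -/
def IsTwisted {B : Type w} [Ring B] (S : ObjectCrossedSystem Γ (fun _ => B)) : Prop :=
  ∀ {e f : Γ} (σ : e ⟶ f) (b : B), S.α σ b = b

end ObjectCrossedSystem

namespace CategoryTheory.Subgroupoid

variable {Γ : Type u} [Groupoid.{v} Γ] (Δ : Subgroupoid Γ)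

/-- The coset `σΛ` of `σ : f → e`, where `Λ` is the isotropy groupoid of `Δ`; it consists of the
composites `σδ` with `δ ∈ Δ(f)`. -/
def isoCoset {f e : Γ} (σ : f ⟶ e) : Set (f ⟶ e) :=
  {ρ | ∃ δ ∈ Δ.arrows f f, ρ = δ ≫ σ}

/-- `T` (with `T f e` the set of its members from `f` to `e`) is a set of representatives for
right `Λ`-equivalence on the morphisms of `Γ`: `σ` and `τ` are equivalent if `σΛ = τΛ`. As `σΛ`
determines the domain and range of `σ`, this is a condition on each `Γ(f,e)` separately. -/
def IsTransversal (T : ∀ f e : Γ, Set (f ⟶ e)) : Prop :=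
  ∀ (f e : Γ) (σ : f ⟶ e), ∃! τ, τ ∈ T f e ∧ Δ.isoCoset τ = Δ.isoCoset σ

variable {Δ}

/-- The isotropy group `Δ(e)` of a wide subgroupoid, as a subgroup of `Γ(e)`. -/
def IsWide.isotropy (hΔ : Δ.IsWide) (e : Γ) : Subgroup (e ⟶ e) :=
  Δ.vertexSubgroup ⟨𝟙 e, hΔ.wide e⟩

end CategoryTheory.Subgroupoid

end

/-! A section `δ` of the multiplication map is determined by the elements `x_e = δ(1_e u_e)`. What
is required is `(b u_σ) x_e = x_f (b u_σ)` for `σ : e ⟶ f`, and that `x_e` multiplies to `1_e u_e`;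
conversely, such a family gives a section (`isSeparable_of_central`).

Traces give such families: take `x_e = ∑_f ∑_τ u_τ a_f ⊗ u_τ⁻¹` with `τ` running over `T_{f,e}`. A
summand depends only on the coset of `τ`, because `a_f` is central and fixed by `Δ(f)`
(`conjTensor_comp`). Multiplication by `b u_σ` moves the summand of `τ` to that of `στ`
(`leftAct_conjTensor`). The product is the sum of the traces. All `x_e` must come from the same
`a_f`, but `α_σ` carries traces at `e` to traces at `e'`, so by connectedness data at one object
suffice.

Conversely, `R` is the direct sum, as a right `R_Δ`-module, of its parts `R_C` supported in the
cosets `C = σΔ`. Hence `r ⊗ r' ↦ (r_C r')_C` is well defined. The identity coefficients of the image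
of `x_e` are elements `c_e(C)` of `A_e`: finitely many are nonzero, they are central, they satisfy
`α_σ(c_e(τΔ)) = c_f(στΔ)`, and their sum is `1` (`exists_cosetFamily`). So `c_e(τΔ) = α_τ(a_f)` with
`a_f = c_f(Δ)`, where `Δ` stands for the coset of the identity of `f`. Grouping the cosets by the
`Δ`-component of their domains turns the sum into a sum of traces.

For normal `Δ` a trace from `f` to `e` is also one from `e` to `e`, so all terms can be collected at
`e`. In the twisted case a trace is multiplication by the index. -/

noncomputable section

/-! ### Bimodule calculus in the relative tensor product -/

namespace RingExt

variable {R : Type*} [NonUnitalRing R] (S : NonUnitalSubring R)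

/-- The class of `r ⊗ r'` in `R ⊗_S R`. -/
def tmul (r r' : R) : RelTensor S := QuotientAddGroup.mk (r ⊗ₜ[ℤ] r')

theorem leftAct_tmul (a r r' : R) : leftAct S a (tmul S r r') = tmul S (a * r) r' := rfl

theorem rightAct_tmul (a r r' : R) : rightAct S a (tmul S r r') = tmul S r (r' * a) := rfl

theorem mulMap_tmul (r r' : R) : mulMap S (tmul S r r') = r * r' := rfl

theorem mul_tmul {s : R} (hs : s ∈ S) (r r' : R) : tmul S (r * s) r' = tmul S r (s * r') := by
  rw [tmul, tmul, QuotientAddGroup.eq_iff_sub_mem]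
  exact AddSubgroup.subset_closure ⟨r, s, hs, r', rfl⟩

theorem add_tmul (r₁ r₂ r' : R) : tmul S (r₁ + r₂) r' = tmul S r₁ r' + tmul S r₂ r' := by
  rw [tmul, TensorProduct.add_tmul]; rfl

theorem relTensor_hom_ext {M : Type*} [AddCommMonoid M] {φ ψ : RelTensor S →+ M}
    (h : ∀ r r', φ (tmul S r r') = ψ (tmul S r r')) : φ = ψ := by
  refine QuotientAddGroup.addMonoidHom_ext _ ?_
  ext z
  induction z using TensorProduct.induction_on with
  | zero => rw [map_zero, map_zero]
  | tmul r r' => exact h r r'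
  | add x y hx hy => rw [map_add, map_add, hx, hy]

theorem leftAct_add (a b : R) (z : RelTensor S) :
    leftAct S (a + b) z = leftAct S a z + leftAct S b z := by
  refine DFunLike.congr_fun (f := leftAct S (a + b)) (g := leftAct S a + leftAct S b)
    (relTensor_hom_ext S fun r r' => ?_) z
  rw [AddMonoidHom.add_apply, leftAct_tmul, leftAct_tmul, leftAct_tmul, add_mul, add_tmul]

theorem leftAct_zero (z : RelTensor S) : leftAct S 0 z = 0 := by
  simpa using leftAct_add S 0 0 z

theorem leftAct_mul (a b : R) (z : RelTensor S) :
    leftAct S (a * b) z = leftAct S a (leftAct S b z) := by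
  refine DFunLike.congr_fun (f := leftAct S (a * b)) (g := (leftAct S a).comp (leftAct S b))
    (relTensor_hom_ext S fun r r' => ?_) z
  rw [AddMonoidHom.comp_apply, leftAct_tmul, leftAct_tmul, leftAct_tmul, mul_assoc]

theorem rightAct_add (a b : R) (z : RelTensor S) :
    rightAct S (a + b) z = rightAct S a z + rightAct S b z := by
  refine DFunLike.congr_fun (f := rightAct S (a + b)) (g := rightAct S a + rightAct S b)
    (relTensor_hom_ext S fun r r' => ?_) z
  rw [AddMonoidHom.add_apply, rightAct_tmul, rightAct_tmul, rightAct_tmul, mul_add, tmul,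
    TensorProduct.tmul_add]
  rfl

theorem rightAct_zero (z : RelTensor S) : rightAct S 0 z = 0 := by
  simpa using rightAct_add S 0 0 z

theorem rightAct_mul (a b : R) (z : RelTensor S) :
    rightAct S (a * b) z = rightAct S b (rightAct S a z) := by
  refine DFunLike.congr_fun (f := rightAct S (a * b)) (g := (rightAct S b).comp (rightAct S a))
    (relTensor_hom_ext S fun r r' => ?_) z
  rw [AddMonoidHom.comp_apply, rightAct_tmul, rightAct_tmul, rightAct_tmul, mul_assoc]

theorem mulMap_leftAct (a : R) (z : RelTensor S) :
    mulMap S (leftAct S a z) = a * mulMap S z := by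
  refine DFunLike.congr_fun (f := (mulMap S).comp (leftAct S a))
    (g := (AddMonoidHom.mulLeft a).comp (mulMap S)) (relTensor_hom_ext S fun r r' => ?_) z
  exact mul_assoc a r r'

end RingExt

/-! ### Cosets `σΛ` and their representatives -/

namespace CategoryTheory.Subgroupoid

variable {Γ : Type u} [Groupoid.{v} Γ] {Δ : Subgroupoid Γ}

theorem IsWide.isoCoset_eq_iff (hΔ : Δ.IsWide) {f e : Γ} (σ τ : f ⟶ e) :
    Δ.isoCoset σ = Δ.isoCoset τ ↔ ∃ δ ∈ Δ.arrows f f, σ = δ ≫ τ := by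
  constructor
  · intro h
    have : σ ∈ Δ.isoCoset σ := ⟨𝟙 f, hΔ.wide f, (Category.id_comp σ).symm⟩
    rwa [h] at this
  · rintro ⟨δ, hδ, rfl⟩
    ext ρ
    constructor
    · rintro ⟨γ, hγ, rfl⟩
      exact ⟨γ ≫ δ, Δ.mul hγ hδ, by rw [Category.assoc]⟩
    · rintro ⟨γ, hγ, rfl⟩
      exact ⟨γ ≫ Groupoid.inv δ, Δ.mul hγ (Δ.inv hδ), by simp⟩

namespace IsTransversal

variable {T : ∀ f e : Γ, Set (f ⟶ e)}

/-- The representative of the coset of `σ`. -/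
def rep (hT : Δ.IsTransversal T) {f e : Γ} (σ : f ⟶ e) : f ⟶ e := (hT f e σ).choose

theorem rep_mem (hT : Δ.IsTransversal T) {f e : Γ} (σ : f ⟶ e) : hT.rep σ ∈ T f e :=
  (hT f e σ).choose_spec.1.1

theorem isoCoset_rep (hT : Δ.IsTransversal T) {f e : Γ} (σ : f ⟶ e) :
    Δ.isoCoset (hT.rep σ) = Δ.isoCoset σ := (hT f e σ).choose_spec.1.2

theorem eq_of_isoCoset_eq (hT : Δ.IsTransversal T) {f e : Γ} {σ τ : f ⟶ e} (hσ : σ ∈ T f e)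
    (hτ : τ ∈ T f e) (h : Δ.isoCoset σ = Δ.isoCoset τ) : σ = τ :=
  (hT f e τ).unique ⟨hσ, h⟩ ⟨hτ, rfl⟩

/-- A coset-preserving bijection between hom-sets induces a bijection of representatives. -/
theorem bijOn_rep (hT : Δ.IsTransversal T) {f e f' e' : Γ} (φ : (f ⟶ e) ≃ (f' ⟶ e'))
    (hφ : ∀ σ τ, Δ.isoCoset σ = Δ.isoCoset τ ↔ Δ.isoCoset (φ σ) = Δ.isoCoset (φ τ)) :
    Set.BijOn (fun τ => hT.rep (φ τ)) (T f e) (T f' e') := by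
  refine ⟨fun τ _ => hT.rep_mem _, fun τ hτ τ' hτ' h => ?_, fun τ hτ => ?_⟩
  · refine hT.eq_of_isoCoset_eq hτ hτ' ((hφ _ _).2 ?_)
    rw [← hT.isoCoset_rep (φ τ), ← hT.isoCoset_rep (φ τ')]
    exact congrArg _ h
  · refine ⟨hT.rep (φ.symm τ), hT.rep_mem _, hT.eq_of_isoCoset_eq (hT.rep_mem _) hτ ?_⟩
    rw [hT.isoCoset_rep, (hφ _ _).1 (hT.isoCoset_rep (φ.symm τ)), φ.apply_symm_apply]

/-- For coset-invariant summands the choice of representatives is immaterial. So `φ` may serve as a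
change of variables although it need not map one set of representatives to the other. -/
theorem finsum_mem_comp (hT : Δ.IsTransversal T) {f e f' e' : Γ} (φ : (f ⟶ e) ≃ (f' ⟶ e'))
    (hφ : ∀ σ τ, Δ.isoCoset σ = Δ.isoCoset τ ↔ Δ.isoCoset (φ σ) = Δ.isoCoset (φ τ))
    {M : Type*} [AddCommMonoid M] (g : (f' ⟶ e') → M)
    (hg : ∀ σ τ, Δ.isoCoset σ = Δ.isoCoset τ → g σ = g τ) :
    ∑ᶠ τ ∈ T f e, g (φ τ) = ∑ᶠ τ ∈ T f' e', g τ :=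
  finsum_mem_eq_of_bijOn _ (hT.bijOn_rep φ hφ) fun τ _ => hg _ _ (hT.isoCoset_rep (φ τ)).symm

end IsTransversal

/-- Composition with `σ` as a bijection of hom-sets. -/
def postcompEquiv {e e' : Γ} (f : Γ) (σ : e ⟶ e') : (f ⟶ e) ≃ (f ⟶ e') where
  toFun τ := τ ≫ σ
  invFun τ := τ ≫ Groupoid.inv σ
  left_inv τ := by simp
  right_inv τ := by simp

/-- Precomposition with `σ` as a bijection of hom-sets. -/
def precompEquiv {f f' : Γ} (e : Γ) (σ : f ⟶ f') : (f' ⟶ e) ≃ (f ⟶ e) where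
  toFun τ := σ ≫ τ
  invFun τ := Groupoid.inv σ ≫ τ
  left_inv τ := by simp
  right_inv τ := by simp

theorem IsWide.isoCoset_postcomp (hΔ : Δ.IsWide) {e e' : Γ} (f : Γ) (ρ : e ⟶ e')
    (σ τ : f ⟶ e) : Δ.isoCoset σ = Δ.isoCoset τ ↔
      Δ.isoCoset (postcompEquiv f ρ σ) = Δ.isoCoset (postcompEquiv f ρ τ) := by
  rw [hΔ.isoCoset_eq_iff, hΔ.isoCoset_eq_iff]
  refine exists_congr fun δ => and_congr_right fun _ => ?_
  rw [← (postcompEquiv f ρ).injective.eq_iff]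
  simp [postcompEquiv]

/-- Here the factor `δ` has to pass `ρ`, which replaces it by a conjugate; this is where normality
enters. -/
theorem IsNormal.isoCoset_precomp (hΔ : Δ.IsNormal) {f f' : Γ} (e : Γ) (ρ : f ⟶ f')
    (σ τ : f' ⟶ e) : Δ.isoCoset σ = Δ.isoCoset τ ↔
      Δ.isoCoset (precompEquiv e ρ σ) = Δ.isoCoset (precompEquiv e ρ τ) := by
  rw [hΔ.toIsWide.isoCoset_eq_iff, hΔ.toIsWide.isoCoset_eq_iff]
  constructor
  · rintro ⟨δ, hδ, rfl⟩
    refine ⟨ρ ≫ δ ≫ Groupoid.inv ρ, ?_, by simp [precompEquiv]⟩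
    simpa using hΔ.conj (Groupoid.inv ρ) hδ
  · rintro ⟨δ, hδ, h⟩
    refine ⟨Groupoid.inv ρ ≫ δ ≫ ρ, hΔ.conj ρ hδ, (precompEquiv e ρ).injective ?_⟩
    rw [h]
    simp [precompEquiv]

/-- The representatives from `f` to `e` correspond to the cosets of `Δ(f)` in `Γ(f)`. -/
def IsTransversal.equivQuotient {T : ∀ f e : Γ, Set (f ⟶ e)} (hT : Δ.IsTransversal T)
    (hΔ : Δ.IsWide) {f e : Γ} (σ : f ⟶ e) : T f e ≃ (f ⟶ f) ⧸ hΔ.isotropy f :=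
  Equiv.ofBijective
    -- The vertex group multiplies by `≫`, so the classes `δ ≫ τ` are right cosets of `Δ(f)`,
    -- whereas the quotient consists of left cosets. Inverting `τ` exchanges the two.
    (fun τ => QuotientGroup.mk (s := hΔ.isotropy f) (σ ≫ Groupoid.inv τ.1 : f ⟶ f)) <| by
    constructor
    · intro τ τ' h
      have h' : (σ ≫ Groupoid.inv τ.1 : f ⟶ f)⁻¹ * (σ ≫ Groupoid.inv τ'.1 : f ⟶ f) ∈
        hΔ.isotropy f := QuotientGroup.eq.1 h
      refine Subtype.ext (hT.eq_of_isoCoset_eq τ.2 τ'.2 ((hΔ.isoCoset_eq_iff _ _).2 ⟨_, h', ?_⟩))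
      change τ.1 = (Groupoid.inv (σ ≫ Groupoid.inv τ.1) ≫ (σ ≫ Groupoid.inv τ'.1)) ≫ τ'.1
      simp
    · intro q
      obtain ⟨γ, rfl⟩ := QuotientGroup.mk_surjective q
      refine ⟨⟨hT.rep (Groupoid.inv (γ : f ⟶ f) ≫ σ), hT.rep_mem _⟩, ?_⟩
      obtain ⟨δ, hδ, h⟩ := (hΔ.isoCoset_eq_iff _ _).1 (hT.isoCoset_rep (Groupoid.inv (γ : f ⟶ f) ≫ σ))
      refine QuotientGroup.eq.2 ?_
      change Groupoid.inv (σ ≫ Groupoid.inv (hT.rep (Groupoid.inv (γ : f ⟶ f) ≫ σ))) ≫ γ ∈ Δ.arrows f f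
      rw [h]
      simpa using hδ

theorem IsTransversal.finiteIndex_iff {T : ∀ f e : Γ, Set (f ⟶ e)} (hT : Δ.IsTransversal T)
    (hΔ : Δ.IsWide) {f e : Γ} (σ : f ⟶ e) : (hΔ.isotropy f).FiniteIndex ↔ (T f e).Finite := by
  rw [Subgroup.finiteIndex_iff_finite_quotient, ← (hT.equivQuotient hΔ σ).finite_iff]
  exact Set.finite_coe_iff

theorem IsTransversal.index_eq {T : ∀ f e : Γ, Set (f ⟶ e)} (hT : Δ.IsTransversal T)
    (hΔ : Δ.IsWide) {f e : Γ} (σ : f ⟶ e) : (hΔ.isotropy f).index = (T f e).ncard :=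
  (Nat.card_congr (hT.equivQuotient hΔ σ)).symm

end CategoryTheory.Subgroupoid

/-! ### Sufficiency: a bimodule section built from traces -/

namespace ObjectCrossedSystem

open CrossedProduct RingExt

variable {Γ : Type u} [Groupoid.{v} Γ] {A : Γ → Type w} [∀ e, Ring (A e)]
variable (S : ObjectCrossedSystem Γ A) (Δ : Subgroupoid Γ)

/-- The monomial `a u_σ` for a morphism `σ` with given domain and range. -/
def homMono {e f : Γ} (σ : e ⟶ f) : A f →+ S.CrossedProduct := mono S ⟨e, f, σ⟩

theorem homMono_mul {e f g : Γ} (σ : f ⟶ g) (τ : e ⟶ f) (a : A g) (b : A f) :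
    S.homMono σ a * S.homMono τ b = S.homMono (τ ≫ σ) (a * S.α σ b * (S.β σ τ : A g)) :=
  mono_mul_mono_comp S σ τ a b

theorem id_mul_homMono {e f : Γ} (σ : e ⟶ f) (a b : A f) :
    S.homMono (𝟙 f) a * S.homMono σ b = S.homMono σ (a * b) := by
  rw [homMono_mul, S.α_id, S.β_id_left, Units.val_one, mul_one, Category.comp_id]

theorem homMono_mul_id {e f : Γ} (σ : e ⟶ f) (a : A f) (b : A e) :
    S.homMono σ a * S.homMono (𝟙 e) b = S.homMono σ (a * S.α σ b) := by
  rw [homMono_mul, S.β_id_right, Units.val_one, mul_one, Category.id_comp]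

theorem homMono_mem {e f : Γ} {σ : e ⟶ f} (hσ : σ ∈ Δ.arrows e f) (a : A f) :
    S.homMono σ a ∈ S.subring Δ := by
  intro τ hτ
  refine coeff_mono_ne S (τ := ⟨e, f, σ⟩) ?_ a
  rintro rfl
  exact hτ hσ

/-- The inverse of the monomial `u_σ`. -/
def monoInv {e f : Γ} (σ : e ⟶ f) : S.CrossedProduct :=
  -- The coefficient is chosen so that its image under `α_σ` cancels `β_{σ,σ⁻¹}`. Only the relation
  -- `u_σ u_σ⁻¹ = 1` is needed below.
  S.homMono (Groupoid.inv σ) ((S.α σ).symm ((S.β σ (Groupoid.inv σ))⁻¹ : (A f)ˣ))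

theorem mono_mul_monoInv {e f : Γ} (σ : e ⟶ f) :
    S.homMono σ 1 * S.monoInv σ = S.homMono (𝟙 f) 1 := by
  rw [monoInv, homMono_mul, RingEquiv.apply_symm_apply, one_mul, Units.inv_mul,
    Groupoid.inv_comp]

theorem monoInv_mul_id {e f : Γ} (σ : e ⟶ f) :
    S.monoInv σ * S.homMono (𝟙 f) 1 = S.monoInv σ := by
  rw [monoInv, homMono_mul_id, map_one, mul_one]

/-- The element `u_τ a ⊗ u_τ⁻¹` of `R ⊗_{R_Δ} R`. -/
def conjTensor {f e : Γ} (a : A f) (τ : f ⟶ e) : RelTensor (S.subring Δ) :=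
  tmul (S.subring Δ) (S.homMono τ 1 * S.homMono (𝟙 f) a) (S.monoInv τ)

variable {Δ}

/-- Write `b u_σ u_τ = u_{στ} c` with `c ∈ A_f`. The central `a` commutes with `c`, wideness puts
`c` into `R_Δ`, so `c` crosses the tensor sign, and there `c u_τ⁻¹ = u_{στ}⁻¹ b u_σ`. -/
theorem leftAct_conjTensor (hΔ : Δ.IsWide) {f e e' : Γ} {a : A f}
    (ha : a ∈ Subring.center (A f)) (τ : f ⟶ e) (σ : e ⟶ e') (b : A e') :
    leftAct (S.subring Δ) (S.homMono σ b) (S.conjTensor Δ a τ) =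
      rightAct (S.subring Δ) (S.homMono σ b) (S.conjTensor Δ a (τ ≫ σ)) := by
  obtain ⟨c, hc⟩ : ∃ c, S.monoInv (τ ≫ σ) * (S.homMono σ b * S.homMono τ 1) =
      S.homMono (𝟙 f) c := by
    rw [monoInv, homMono_mul, homMono_mul, Groupoid.comp_inv]
    exact ⟨_, rfl⟩
  have h1 : S.homMono σ b * S.homMono τ 1 = S.homMono (τ ≫ σ) 1 * S.homMono (𝟙 f) c := by
    rw [← hc, ← mul_assoc, mono_mul_monoInv, ← mul_assoc, id_mul_homMono, one_mul]
  have h2 : S.homMono (𝟙 f) c * S.homMono (𝟙 f) a = S.homMono (𝟙 f) a * S.homMono (𝟙 f) c := by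
    rw [id_mul_homMono, id_mul_homMono, Subring.mem_center_iff.1 ha c]
  rw [conjTensor, conjTensor, leftAct_tmul, rightAct_tmul, ← mul_assoc, h1, mul_assoc, h2,
    ← mul_assoc, mul_tmul _ (S.homMono_mem Δ (hΔ.wide f) c), ← hc, mul_assoc, mul_assoc,
    mono_mul_monoInv, homMono_mul_id S σ, map_one (S.α σ), mul_one b]

/-- Write `u_{τδ} = u_τ (c u_δ)`. Since `a` is central and fixed by `α_δ`, it commutes with `c u_δ ∈
R_Δ`, which then crosses the tensor sign and turns `u_{τδ}⁻¹` into `u_τ⁻¹`. -/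
theorem conjTensor_comp {f e : Γ} {a : A f} (ha : a ∈ S.fixedCenter Δ f) {δ : f ⟶ f}
    (hδ : δ ∈ Δ.arrows f f) (τ : f ⟶ e) :
    S.conjTensor Δ a (δ ≫ τ) = S.conjTensor Δ a τ := by
  obtain ⟨c, hc⟩ : ∃ c, S.monoInv τ * S.homMono (δ ≫ τ) 1 = S.homMono δ c := by
    rw [monoInv, homMono_mul, Category.assoc, Groupoid.comp_inv, Category.comp_id]
    exact ⟨_, rfl⟩
  have h1 : S.homMono (δ ≫ τ) 1 = S.homMono τ 1 * S.homMono δ c := by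
    rw [← hc, ← mul_assoc, mono_mul_monoInv, id_mul_homMono, one_mul]
  have h2 : S.homMono δ c * S.homMono (𝟙 f) a = S.homMono (𝟙 f) a * S.homMono δ c := by
    rw [homMono_mul_id, id_mul_homMono, ha.2 δ hδ, Subring.mem_center_iff.1 ha.1 c]
  rw [conjTensor, conjTensor, h1, mul_assoc, h2, ← mul_assoc,
    mul_tmul _ (S.homMono_mem Δ hδ c), ← hc, mul_assoc, mono_mul_monoInv, monoInv_mul_id]

theorem conjTensor_eq (hΔ : Δ.IsWide) {f e : Γ} {a : A f} (ha : a ∈ S.fixedCenter Δ f)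
    (σ τ : f ⟶ e) (h : Δ.isoCoset σ = Δ.isoCoset τ) :
    S.conjTensor Δ a σ = S.conjTensor Δ a τ := by
  obtain ⟨δ, hδ, rfl⟩ := (hΔ.isoCoset_eq_iff _ _).1 h
  exact S.conjTensor_comp ha hδ τ

theorem mulMap_conjTensor {f e : Γ} (a : A f) (τ : f ⟶ e) :
    mulMap (S.subring Δ) (S.conjTensor Δ a τ) = S.homMono (𝟙 e) (S.α τ a) := by
  have h : S.homMono τ 1 * S.homMono (𝟙 f) a = S.homMono (𝟙 e) (S.α τ a) * S.homMono τ 1 := by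
    rw [homMono_mul_id, id_mul_homMono, one_mul, mul_one]
  rw [conjTensor, mulMap_tmul, h, mul_assoc, mono_mul_monoInv, id_mul_homMono, mul_one]

/-- Conjugation by `β_{σ,τ}` is trivial on the centre, so `α` is strictly functorial there. -/
theorem α_comp_of_mem_center {e f g : Γ} (σ : f ⟶ g) (τ : e ⟶ f) {a : A e}
    (ha : a ∈ Subring.center (A e)) : S.α σ (S.α τ a) = S.α (τ ≫ σ) a := by
  have h : S.α (τ ≫ σ) a ∈ Subring.center (A g) := by
    rw [Subring.mem_center_iff] at ha ⊢
    intro x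
    obtain ⟨y, rfl⟩ := (S.α (τ ≫ σ)).surjective x
    rw [← map_mul, ha, map_mul]
  rw [S.α_comp, Subring.mem_center_iff.1 h, mul_assoc, Units.mul_inv, mul_one]

theorem α_mem_center {e f : Γ} (σ : e ⟶ f) {a : A e} (ha : a ∈ Subring.center (A e)) :
    S.α σ a ∈ Subring.center (A f) := by
  rw [Subring.mem_center_iff] at ha ⊢
  intro x
  obtain ⟨y, rfl⟩ := (S.α σ).surjective x
  rw [← map_mul, ha, map_mul]

theorem α_eq_of_isoCoset_eq (hΔ : Δ.IsWide) {f e : Γ} {a : A f} (ha : a ∈ S.fixedCenter Δ f)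
    (σ τ : f ⟶ e) (h : Δ.isoCoset σ = Δ.isoCoset τ) : S.α σ a = S.α τ a := by
  obtain ⟨δ, hδ, rfl⟩ := (hΔ.isoCoset_eq_iff _ _).1 h
  rw [← S.α_comp_of_mem_center τ δ ha.1, ha.2 δ hδ]

variable {T : ∀ f e : Γ, Set (f ⟶ e)}

/-- Composition with `σ` permutes the cosets, taking those with range `e` to those with range `e'`.
-/
theorem α_relTrace (hΔ : Δ.IsWide) (hT : Δ.IsTransversal T) {f e e' : Γ} (hfin : (T f e).Finite)
    {a : A f} (ha : a ∈ S.fixedCenter Δ f) (σ : e ⟶ e') :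
    S.α σ (S.relTrace T f e a) = S.relTrace T f e' a := by
  rw [relTrace, relTrace, ← hT.finsum_mem_comp (Subgroupoid.postcompEquiv f σ)
    (hΔ.isoCoset_postcomp f σ) _ (S.α_eq_of_isoCoset_eq hΔ ha)]
  refine ((S.α σ).toAddMonoidHom.map_finsum_mem _ hfin).trans ?_
  exact finsum_mem_congr rfl fun τ _ => S.α_comp_of_mem_center σ τ ha.1

/-- Compatible central elements `x e` give a bimodule section of the multiplication map. -/
theorem isSeparable_of_central (x : Γ → RelTensor (S.subring Δ))
    (hx : ∀ {e e' : Γ} (σ : e ⟶ e') (b : A e'), leftAct (S.subring Δ) (S.homMono σ b) (x e) =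
      rightAct (S.subring Δ) (S.homMono σ b) (x e'))
    (hμ : ∀ e, mulMap (S.subring Δ) (x e) = S.homMono (𝟙 e) 1) :
    IsSeparable (S.subring Δ) := by
  let δ : S.CrossedProduct →+ RelTensor (S.subring Δ) := CrossedProduct.lift S fun σ =>
    AddMonoidHom.mk' (fun a => leftAct (S.subring Δ) (mono S σ a) (x σ.1))
      (fun a b => by rw [map_add, leftAct_add])
  have hδ : ∀ (σ : Arr Γ) (a : A σ.2.1),
      δ (mono S σ a) = leftAct (S.subring Δ) (mono S σ a) (x σ.1) :=
    fun σ a => CrossedProduct.lift_mono S _ σ a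
  -- With both descriptions of `δ` available, left linearity follows from the first and right
  -- linearity from the second.
  have hδ' : ∀ (σ : Arr Γ) (a : A σ.2.1),
      δ (mono S σ a) = rightAct (S.subring Δ) (mono S σ a) (x σ.2.1) :=
    fun σ a => (hδ σ a).trans (hx σ.2.2 a)
  refine ⟨δ, fun a y => ?_, fun y a => ?_, fun y => ?_⟩
  · refine CrossedProduct.induction S (p := fun a => δ (a * y) = leftAct _ a (δ y)) a
      (by rw [zero_mul, map_zero, leftAct_zero]) (fun σ a => ?_)
      (fun a b ha hb => by rw [add_mul, map_add, ha, hb, leftAct_add])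
    refine CrossedProduct.induction S (p := fun y => δ (_ * y) = leftAct _ _ (δ y)) y
      (by rw [mul_zero, map_zero, map_zero]) (fun τ b => ?_)
      (fun a b ha hb => by rw [mul_add, map_add, ha, hb, map_add, map_add])
    rw [hδ, ← leftAct_mul]
    obtain ⟨e, f, s⟩ := σ
    obtain ⟨d, e', t⟩ := τ
    by_cases h : e' = e
    · subst h
      rw [mono_mul_mono_comp, hδ]
    · rw [mono_mul_mono_zero S ⟨e, f, s⟩ ⟨d, e', t⟩ h, map_zero, leftAct_zero]
  · refine CrossedProduct.induction S (p := fun a => δ (y * a) = rightAct _ a (δ y)) a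
      (by rw [mul_zero, map_zero, rightAct_zero]) (fun σ a => ?_)
      (fun a b ha hb => by rw [mul_add, map_add, ha, hb, rightAct_add])
    refine CrossedProduct.induction S (p := fun y => δ (y * _) = rightAct _ _ (δ y)) y
      (by rw [zero_mul, map_zero, map_zero]) (fun τ b => ?_)
      (fun a b ha hb => by rw [add_mul, map_add, ha, hb, map_add, map_add])
    rw [hδ', ← rightAct_mul]
    obtain ⟨e, f, s⟩ := σ
    obtain ⟨d, e', t⟩ := τ
    by_cases h : f = d
    · subst h
      rw [mono_mul_mono_comp, hδ']
    · rw [mono_mul_mono_zero S ⟨d, e', t⟩ ⟨e, f, s⟩ h, map_zero, rightAct_zero]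
  · refine CrossedProduct.induction S (p := fun y => mulMap _ (δ y) = y) y
      (by rw [map_zero, map_zero]) (fun τ b => ?_)
      (fun a b ha hb => by rw [map_add, map_add, ha, hb])
    rw [hδ, mulMap_leftAct, hμ]
    exact (S.homMono_mul_id τ.2.2 b 1).trans (by rw [map_one, mul_one]; rfl)

theorem isSeparable_of_sum_relTrace (hΔ : Δ.IsWide) (hT : Δ.IsTransversal T) (F : Finset Γ)
    (a : ∀ f, A f) (hfin : ∀ f ∈ F, ∀ e, (T f e).Finite) (ha : ∀ f ∈ F, a f ∈ S.fixedCenter Δ f)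
    (h1 : ∀ e, ∑ f ∈ F, S.relTrace T f e (a f) = 1) : IsSeparable (S.subring Δ) := by
  refine S.isSeparable_of_central
    (fun e => ∑ f ∈ F, ∑ᶠ τ ∈ T f e, S.conjTensor Δ (a f) τ) (fun {e e'} σ b => ?_) (fun e => ?_)
  · rw [map_sum, map_sum]
    refine Finset.sum_congr rfl fun f hf => ?_
    rw [← hT.finsum_mem_comp (Subgroupoid.postcompEquiv f σ)
      (hΔ.isoCoset_postcomp f σ) _ (S.conjTensor_eq hΔ (ha f hf)),
      AddMonoidHom.map_finsum_mem _ _ (hfin f hf e), AddMonoidHom.map_finsum_mem _ _ (hfin f hf e)]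
    exact finsum_mem_congr rfl fun τ _ => S.leftAct_conjTensor hΔ (ha f hf).1 τ σ b
  · rw [map_sum, ← h1 e, map_sum]
    refine Finset.sum_congr rfl fun f hf => ?_
    rw [AddMonoidHom.map_finsum_mem _ _ (hfin f hf e), relTrace,
      AddMonoidHom.map_finsum_mem _ _ (hfin f hf e)]
    exact finsum_mem_congr rfl fun τ _ => S.mulMap_conjTensor _ τ

end ObjectCrossedSystem

/-! ### Cosets `σΔ` of the whole subgroupoid -/

namespace CategoryTheory.Subgroupoid

variable {Γ : Type u} [Groupoid.{v} Γ] {Δ : Subgroupoid Γ}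

variable (Δ) in
/-- Two morphisms `σ` and `τ` of `Γ` are related if `τ = σδ` for some `δ ∈ Δ`. -/
inductive CosetRel : Arr Γ → Arr Γ → Prop
  | comp {d' d e : Γ} (δ : d' ⟶ d) (hδ : δ ∈ Δ.arrows d' d) (s : d ⟶ e) :
    CosetRel ⟨d, e, s⟩ ⟨d', e, δ ≫ s⟩

/-- The equivalence relation `σΔ = τΔ` on the morphisms of `Γ`. -/
def IsWide.cosetSetoid (hΔ : Δ.IsWide) : Setoid (Arr Γ) where
  r := Δ.CosetRel
  iseqv :=
    { refl := fun ⟨d, e, s⟩ => by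
        simpa using CosetRel.comp (𝟙 d) (hΔ.wide d) s
      symm := by
        rintro _ _ ⟨δ, hδ, s⟩
        simpa using CosetRel.comp (Groupoid.inv δ) (Δ.inv hδ) (δ ≫ s)
      trans := by
        rintro _ _ _ ⟨δ, hδ, s⟩ h
        rcases h with ⟨γ, hγ⟩
        simpa using CosetRel.comp (γ ≫ δ) (Δ.mul hγ hδ) s }

/-- The equivalence relation on the objects given by the connected components of `Δ`. -/
def IsWide.objSetoid (hΔ : Δ.IsWide) : Setoid Γ where
  r d e := ∃ δ : d ⟶ e, δ ∈ Δ.arrows d e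
  iseqv :=
    { refl := fun d => ⟨𝟙 d, hΔ.wide d⟩
      symm := fun ⟨_, h⟩ => ⟨_, Δ.inv h⟩
      trans := fun ⟨_, h⟩ ⟨_, h'⟩ => ⟨_, Δ.mul h h'⟩ }

/-- The set of cosets `σΔ`. -/
abbrev IsWide.Coset (hΔ : Δ.IsWide) : Type (max u v) := _root_.Quotient hΔ.cosetSetoid

/-- The coset `σΔ`. -/
def IsWide.coset (hΔ : Δ.IsWide) {d e : Γ} (σ : d ⟶ e) : hΔ.Coset := _root_.Quotient.mk _ ⟨d, e, σ⟩

theorem IsWide.coset_eq_iff (hΔ : Δ.IsWide) {d d' e : Γ} (σ : d ⟶ e) (τ : d' ⟶ e) :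
    hΔ.coset σ = hΔ.coset τ ↔ ∃ δ ∈ Δ.arrows d' d, τ = δ ≫ σ := by
  refine _root_.Quotient.eq.trans ⟨fun h => ?_, ?_⟩
  · cases (h : Δ.CosetRel _ _) with
    | comp δ hδ => exact ⟨δ, hδ, rfl⟩
  · rintro ⟨δ, hδ, rfl⟩
    exact CosetRel.comp δ hδ σ

/-- The range of the members of a coset. -/
def IsWide.cosetRange (hΔ : Δ.IsWide) : hΔ.Coset → Γ :=
  _root_.Quotient.lift (fun σ => σ.2.1) (by rintro _ _ ⟨⟩; rfl)

/-- The chosen object in the connected component of `Δ` which contains the domains of the members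
of a coset. -/
def IsWide.cosetObj (hΔ : Δ.IsWide) (C : hΔ.Coset) : Γ :=
  (_root_.Quotient.lift (s := hΔ.cosetSetoid)
    (fun σ : Arr Γ => (_root_.Quotient.mk hΔ.objSetoid σ.1)) (by
      rintro _ _ ⟨δ, hδ, -⟩
      exact (_root_.Quotient.sound ⟨δ, hδ⟩ : _root_.Quotient.mk hΔ.objSetoid _ = _).symm) C).out

theorem IsWide.cosetObj_coset_cosetObj (hΔ : Δ.IsWide) (C : hΔ.Coset) {e : Γ}
    (σ : hΔ.cosetObj C ⟶ e) : hΔ.cosetObj (hΔ.coset σ) = hΔ.cosetObj C :=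
  congrArg _root_.Quotient.out (_root_.Quotient.out_eq _)

/-- Every coset with range `e` is the coset of a representative. -/
theorem IsTransversal.exists_coset_eq {T : ∀ f e : Γ, Set (f ⟶ e)} (hT : Δ.IsTransversal T)
    (hΔ : Δ.IsWide) (C : hΔ.Coset) {e : Γ} (he : hΔ.cosetRange C = e) :
    ∃ τ ∈ T (hΔ.cosetObj C) e, hΔ.coset τ = C := by
  subst he
  induction C using _root_.Quotient.inductionOn with
  | h σ =>
    obtain ⟨d, e, s⟩ := σ
    obtain ⟨δ, hδ⟩ : hΔ.objSetoid (hΔ.cosetObj (hΔ.coset s)) d := _root_.Quotient.mk_out (s := hΔ.objSetoid) d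
    -- Moving the domain along `δ ∈ Δ` to the chosen object of its component stays in the coset
    -- `sΔ`.
    refine ⟨hT.rep (δ ≫ s), hT.rep_mem _, Eq.symm ?_⟩
    obtain ⟨γ, hγ, h⟩ := (hΔ.isoCoset_eq_iff _ _).1 (hT.isoCoset_rep (δ ≫ s))
    exact (hΔ.coset_eq_iff s _).2 ⟨γ ≫ δ, Δ.mul hγ hδ, h.trans (Category.assoc _ _ _).symm⟩

/-- For morphisms with a common domain `f`, the element of `Δ` relating them lies in `Δ(f)`, so
equality of `Δ`-cosets is equality of `Λ`-cosets. -/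
theorem IsTransversal.injOn_coset {T : ∀ f e : Γ, Set (f ⟶ e)} (hT : Δ.IsTransversal T)
    (hΔ : Δ.IsWide) (f e : Γ) : Set.InjOn (fun τ : f ⟶ e => hΔ.coset τ) (T f e) := by
  intro σ hσ τ hτ h
  exact hT.eq_of_isoCoset_eq hσ hτ
    ((hΔ.isoCoset_eq_iff _ _).2 ((hΔ.coset_eq_iff τ σ).1 h.symm))

end CategoryTheory.Subgroupoid

/-! ### Necessity: traces extracted from a bimodule section -/

namespace ObjectCrossedSystem

open CrossedProduct RingExt

variable {Γ : Type u} [Groupoid.{v} Γ] {A : Γ → Type w} [∀ e, Ring (A e)]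
variable (S : ObjectCrossedSystem Γ A) {Δ : Subgroupoid Γ}

theorem coeff_homMono {e f : Γ} (σ : e ⟶ f) (a : A f) :
    coeff S ⟨e, f, σ⟩ (S.homMono σ a) = a := by
  classical
  exact DFinsupp.single_eq_same (β := fun σ : Arr Γ => A σ.2.1)

/-- By cancellation `στ = σ` forces `τ` to be an identity, so only one term of `y` contributes.
Together with `coeff_mul_homMono` this turns a commutation relation in `R` into one between identity
coefficients. -/
theorem coeff_homMono_mul {e f : Γ} (σ : e ⟶ f) (b : A f) (y : S.CrossedProduct) :
    coeff S ⟨e, f, σ⟩ (S.homMono σ b * y) = b * S.α σ (coeff S ⟨e, e, 𝟙 e⟩ y) := by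
  refine CrossedProduct.induction S
    (p := fun y => coeff S ⟨e, f, σ⟩ (S.homMono σ b * y) = b * S.α σ (coeff S ⟨e, e, 𝟙 e⟩ y)) y
    (by rw [mul_zero, map_zero, map_zero, map_zero, mul_zero]) (fun τ c => ?_)
    (fun y z hy hz => by rw [mul_add, map_add, map_add, map_add, mul_add, hy, hz])
  obtain ⟨d, e', t⟩ := τ
  by_cases h : e' = e
  · subst h
    rw [homMono, mono_mul_mono_comp]
    by_cases hτ : (⟨d, e', t⟩ : Arr Γ) = ⟨e', e', 𝟙 e'⟩
    · cases hτ
      rw [S.β_id_right, Units.val_one, mul_one, Category.id_comp]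
      exact (S.coeff_homMono σ _).trans 
        (congrArg (fun x => b * S.α σ x) (S.coeff_homMono (𝟙 _) c).symm)
    · rw [coeff_mono_ne S hτ, map_zero, mul_zero, coeff_mono_ne]
      intro h
      apply hτ
      obtain ⟨rfl, h⟩ := Sigma.mk.inj_iff.1 h
      obtain ⟨-, h⟩ := Sigma.mk.inj_iff.1 (eq_of_heq h)
      have h := congrArg (· ≫ Groupoid.inv σ) (eq_of_heq h)
      simp only [Category.assoc, Groupoid.comp_inv, Category.comp_id] at h
      rw [h]
  · rw [homMono, mono_mul_mono_zero S ⟨e, f, σ⟩ ⟨d, e', t⟩ h, map_zero, coeff_mono_ne, map_zero,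
      mul_zero]
    intro h'
    exact h (congrArg (fun σ => σ.2.1) h')

theorem coeff_mul_homMono {e f : Γ} (σ : e ⟶ f) (b : A f) (y : S.CrossedProduct) :
    coeff S ⟨e, f, σ⟩ (y * S.homMono σ b) =
      coeff S ⟨f, f, 𝟙 f⟩ y * S.α (𝟙 f) b := by
  refine CrossedProduct.induction S
    (p := fun y => coeff S ⟨e, f, σ⟩ (y * S.homMono σ b) =
      coeff S ⟨f, f, 𝟙 f⟩ y * S.α (𝟙 f) b) y
    (by rw [zero_mul, map_zero, map_zero, zero_mul]) (fun τ c => ?_)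
    (fun y z hy hz => by rw [add_mul, map_add, map_add, add_mul, hy, hz])
  obtain ⟨f', g, t⟩ := τ
  by_cases h : f = f'
  · subst h
    rw [homMono, mono_mul_mono_comp]
    by_cases hτ : (⟨f, g, t⟩ : Arr Γ) = ⟨f, f, 𝟙 f⟩
    · cases hτ
      rw [S.β_id_left, Units.val_one, mul_one, Category.comp_id]
      exact (S.coeff_homMono σ _).trans (by rw [show mono S ⟨f, f, 𝟙 f⟩ c =
        S.homMono (𝟙 f) c from rfl, coeff_homMono])
    · rw [coeff_mono_ne S hτ, zero_mul, coeff_mono_ne]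
      intro h
      apply hτ
      obtain ⟨-, h⟩ := Sigma.mk.inj_iff.1 h
      obtain ⟨rfl, h⟩ := Sigma.mk.inj_iff.1 (eq_of_heq h)
      have h := congrArg (Groupoid.inv σ ≫ ·) (eq_of_heq h)
      simp only [← Category.assoc, Groupoid.inv_comp, Category.id_comp] at h
      rw [h]
  · rw [homMono, mono_mul_mono_zero S ⟨f', g, t⟩ ⟨e, f, σ⟩ h, map_zero, coeff_mono_ne, zero_mul]
    intro h'
    exact h (congrArg (fun σ => σ.1) h').symm

/-- The decomposition of `R` along the cosets `σΔ`. -/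
def cosetProj (hΔ : Δ.IsWide) : S.CrossedProduct →+ (hΔ.Coset →₀ S.CrossedProduct) :=
  CrossedProduct.lift S fun σ =>
    (Finsupp.singleAddHom (_root_.Quotient.mk hΔ.cosetSetoid σ)).comp (mono S σ)

theorem cosetProj_homMono (hΔ : Δ.IsWide) {e f : Γ} (σ : e ⟶ f) (a : A f) :
    S.cosetProj hΔ (S.homMono σ a) = Finsupp.single (hΔ.coset σ) (S.homMono σ a) :=
  CrossedProduct.lift_mono S _ _ _

/-- Right multiplication on families of elements of `R`. -/
def mulRightFinsupp (hΔ : Δ.IsWide) (y : S.CrossedProduct) :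
    (hΔ.Coset →₀ S.CrossedProduct) →+ (hΔ.Coset →₀ S.CrossedProduct) :=
  Finsupp.mapRange.addMonoidHom (AddMonoidHom.mulRight y)

theorem mulRightFinsupp_apply (hΔ : Δ.IsWide) (y : S.CrossedProduct)
    (x : hΔ.Coset →₀ S.CrossedProduct) (C : hΔ.Coset) :
    S.mulRightFinsupp hΔ y x C = x C * y := rfl

theorem mulRightFinsupp_single (hΔ : Δ.IsWide) (x y : S.CrossedProduct) (C : hΔ.Coset) :
    S.mulRightFinsupp hΔ y (Finsupp.single C x) = Finsupp.single C (x * y) := by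
  rw [mulRightFinsupp, Finsupp.mapRange.addMonoidHom_apply, Finsupp.mapRange_single]
  rfl

/-- Right multiplication by a morphism of `Δ` does not leave a coset `σΔ`. This makes `r ⊗ r' ↦ (r_C
r')_C` balanced over `R_Δ`. -/
theorem cosetProj_mul (hΔ : Δ.IsWide) (r s : S.CrossedProduct) (hs : s ∈ S.subring Δ) :
    S.cosetProj hΔ (r * s) = S.mulRightFinsupp hΔ s (S.cosetProj hΔ r) := by
  have hs' := mem_closure_mono S Δ s hs
  clear hs
  induction hs' using AddSubmonoid.closure_induction with
  | zero => ext1 C; rw [mul_zero, map_zero, mulRightFinsupp_apply, mul_zero]; rfl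
  | add x y _ _ hx hy =>
    ext1 C
    rw [mul_add, map_add, hx, hy, Finsupp.add_apply]
    simp only [mulRightFinsupp_apply, mul_add]
  | mem y h =>
    obtain ⟨τ, hτ, b, rfl⟩ := h
    refine CrossedProduct.induction S
      (p := fun r => S.cosetProj hΔ (r * _) = S.mulRightFinsupp hΔ _ (S.cosetProj hΔ r)) r
      (by rw [zero_mul, map_zero, map_zero]) (fun σ a => ?_)
      (fun x y hx hy => by rw [add_mul, map_add, hx, hy, map_add, map_add])
    obtain ⟨f, g, s⟩ := σ
    obtain ⟨e, f', t⟩ := τ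
    refine Eq.trans ?_ (congrArg (S.mulRightFinsupp hΔ _) (S.cosetProj_homMono hΔ s a).symm)
    refine Eq.trans ?_ (S.mulRightFinsupp_single hΔ _ _ _).symm
    change _ = Finsupp.single (hΔ.coset s) (mono S ⟨f, g, s⟩ a * mono S ⟨e, f', t⟩ b)
    by_cases h : f' = f
    · subst h
      rw [mono_mul_mono_comp]
      refine (S.cosetProj_homMono hΔ (t ≫ s) _).trans ?_
      rw [(hΔ.coset_eq_iff s (t ≫ s)).2 ⟨t, hτ, rfl⟩]
      rfl
    · rw [mono_mul_mono_zero S ⟨f, g, s⟩ ⟨e, f', t⟩ h, map_zero, Finsupp.single_zero]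

/-- The biadditive map `(r, r') ↦ (r_C r')_C`, with `r_C` the part of `r` supported in the coset
`C`. -/
def cosetProjMul (hΔ : Δ.IsWide) :
    S.CrossedProduct →+ S.CrossedProduct →+ (hΔ.Coset →₀ S.CrossedProduct) :=
  AddMonoidHom.mk' (fun r => AddMonoidHom.mk' (fun r' => S.mulRightFinsupp hΔ r' (S.cosetProj hΔ r))
      (fun x y => by
        ext1 C; simp only [mulRightFinsupp_apply, Finsupp.add_apply, mul_add]))
    (fun x y => by
      ext1 r'; simp only [AddMonoidHom.mk'_apply, AddMonoidHom.add_apply, map_add])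

/-- The map `R ⊗_{R_Δ} R → ⨁ R`, `r ⊗ r' ↦ (r_C r')_C`, with `r_C` the part of `r` supported in
the coset `C`. -/
def cosetTensorProj (hΔ : Δ.IsWide) :
    RelTensor (S.subring Δ) →+ (hΔ.Coset →₀ S.CrossedProduct) :=
  QuotientAddGroup.lift (balancing (S.subring Δ))
    (TensorProduct.liftAddHom (S.cosetProjMul hΔ) fun n x y => by
      rw [map_zsmul, map_zsmul, AddMonoidHom.zsmul_apply]) <| by
    rw [balancing, AddSubgroup.closure_le]
    rintro _ ⟨r, s, hs, r', rfl⟩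
    rw [SetLike.mem_coe, AddMonoidHom.mem_ker, map_sub, TensorProduct.liftAddHom_tmul,
      TensorProduct.liftAddHom_tmul, sub_eq_zero]
    change S.mulRightFinsupp hΔ r' _ = S.mulRightFinsupp hΔ (s * r') _
    rw [S.cosetProj_mul hΔ r s hs]
    ext1 C
    simp only [mulRightFinsupp_apply, mul_assoc]

theorem cosetTensorProj_tmul (hΔ : Δ.IsWide) (r r' : S.CrossedProduct) :
    S.cosetTensorProj hΔ (tmul _ r r') = S.mulRightFinsupp hΔ r' (S.cosetProj hΔ r) := rfl

theorem cosetTensorProj_rightAct (hΔ : Δ.IsWide) (y : S.CrossedProduct)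
    (z : RelTensor (S.subring Δ)) : S.cosetTensorProj hΔ (rightAct _ y z) =
      S.mulRightFinsupp hΔ y (S.cosetTensorProj hΔ z) := by
  refine DFunLike.congr_fun (f := (S.cosetTensorProj hΔ).comp (rightAct _ y))
    (g := (S.mulRightFinsupp hΔ y).comp (S.cosetTensorProj hΔ))
    (relTensor_hom_ext _ fun r r' => ?_) z
  ext1 C
  rw [AddMonoidHom.comp_apply, AddMonoidHom.comp_apply, rightAct_tmul, cosetTensorProj_tmul,
    cosetTensorProj_tmul]
  simp only [mulRightFinsupp_apply, mul_assoc]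

/-- Left multiplication by `σ` maps `τΔ` to `στΔ`, and injectively on cosets with range `e`, so
nothing else lands in `στΔ`. -/
theorem cosetProj_homMono_mul (hΔ : Δ.IsWide) {d e f : Γ} (σ : e ⟶ f) (b : A f) (τ : d ⟶ e)
    (r : S.CrossedProduct) : S.cosetProj hΔ (S.homMono σ b * r) (hΔ.coset (τ ≫ σ)) =
      S.homMono σ b * S.cosetProj hΔ r (hΔ.coset τ) := by
  refine CrossedProduct.induction S (p := fun r => S.cosetProj hΔ (S.homMono σ b * r)
      (hΔ.coset (τ ≫ σ)) = S.homMono σ b * S.cosetProj hΔ r (hΔ.coset τ)) r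
    (by simp only [mul_zero, map_zero, Finsupp.zero_apply]) (fun ρ a => ?_)
    (fun x y hx hy => by simp only [mul_add, map_add, Finsupp.add_apply, hx, hy])
  obtain ⟨d', e', ρ⟩ := ρ
  rw [show mono S ⟨d', e', ρ⟩ a = S.homMono ρ a from rfl]
  by_cases h : e' = e
  · subst h
    rw [homMono_mul, cosetProj_homMono, cosetProj_homMono]
    have key : hΔ.coset (ρ ≫ σ) = hΔ.coset (τ ≫ σ) ↔ hΔ.coset ρ = hΔ.coset τ := by
      rw [hΔ.coset_eq_iff, hΔ.coset_eq_iff]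
      refine exists_congr fun δ => and_congr_right fun _ => ?_
      rw [← Category.assoc]
      exact (Subgroupoid.postcompEquiv _ σ).injective.eq_iff (a := τ) (b := δ ≫ ρ)
    by_cases hc : hΔ.coset ρ = hΔ.coset τ
    · rw [key.2 hc, hc, Finsupp.single_eq_same, Finsupp.single_eq_same, homMono_mul]
    · rw [Finsupp.single_eq_of_ne (Ne.symm (mt key.1 hc)), Finsupp.single_eq_of_ne (Ne.symm hc),
        mul_zero]
  · rw [cosetProj_homMono, Finsupp.single_eq_of_ne, mul_zero,
      show S.homMono σ b * S.homMono ρ a = 0 from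
        mono_mul_mono_zero S ⟨e, f, σ⟩ ⟨d', e', ρ⟩ h b a, map_zero, Finsupp.zero_apply]
    intro hc
    exact h (congrArg hΔ.cosetRange hc).symm

theorem cosetProj_homMono_mul_of_ne (hΔ : Δ.IsWide) {e f : Γ} (σ : e ⟶ f) (b : A f)
    (C : hΔ.Coset) (hC : hΔ.cosetRange C ≠ f) (r : S.CrossedProduct) :
    S.cosetProj hΔ (S.homMono σ b * r) C = 0 := by
  refine CrossedProduct.induction S (p := fun r => S.cosetProj hΔ (S.homMono σ b * r) C = 0) r
    (by simp only [mul_zero, map_zero, Finsupp.zero_apply]) (fun ρ a => ?_)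
    (fun x y hx hy => by simp only [mul_add, map_add, Finsupp.add_apply, hx, hy, add_zero])
  obtain ⟨d', e', ρ⟩ := ρ
  rw [show mono S ⟨d', e', ρ⟩ a = S.homMono ρ a from rfl]
  by_cases h : e' = e
  · subst h
    rw [homMono_mul, cosetProj_homMono, Finsupp.single_eq_of_ne]
    rintro rfl
    exact hC rfl
  · rw [show S.homMono σ b * S.homMono ρ a = 0 from
        mono_mul_mono_zero S ⟨e, f, σ⟩ ⟨d', e', ρ⟩ h b a, map_zero, Finsupp.zero_apply]

theorem cosetTensorProj_leftAct (hΔ : Δ.IsWide) {d e f : Γ} (σ : e ⟶ f) (b : A f) (τ : d ⟶ e)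
    (z : RelTensor (S.subring Δ)) :
    S.cosetTensorProj hΔ (leftAct _ (S.homMono σ b) z) (hΔ.coset (τ ≫ σ)) =
      S.homMono σ b * S.cosetTensorProj hΔ z (hΔ.coset τ) := by
  refine DFunLike.congr_fun (f := (Finsupp.applyAddHom (hΔ.coset (τ ≫ σ))).comp
    ((S.cosetTensorProj hΔ).comp (leftAct _ (S.homMono σ b))))
    (g := (AddMonoidHom.mulLeft (S.homMono σ b)).comp
      ((Finsupp.applyAddHom (hΔ.coset τ)).comp (S.cosetTensorProj hΔ)))
    (relTensor_hom_ext _ fun r r' => ?_) z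
  change S.cosetProj hΔ (S.homMono σ b * r) (hΔ.coset (τ ≫ σ)) * r' =
    S.homMono σ b * (S.cosetProj hΔ r (hΔ.coset τ) * r')
  rw [cosetProj_homMono_mul, mul_assoc]

theorem cosetTensorProj_leftAct_of_ne (hΔ : Δ.IsWide) {e f : Γ} (σ : e ⟶ f) (b : A f)
    (C : hΔ.Coset) (hC : hΔ.cosetRange C ≠ f) (z : RelTensor (S.subring Δ)) :
    S.cosetTensorProj hΔ (leftAct _ (S.homMono σ b) z) C = 0 := by
  refine DFunLike.congr_fun (f := (Finsupp.applyAddHom C).comp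
    ((S.cosetTensorProj hΔ).comp (leftAct _ (S.homMono σ b)))) (g := 0)
    (relTensor_hom_ext _ fun r r' => ?_) z
  change S.cosetProj hΔ (S.homMono σ b * r) C * r' = 0
  rw [S.cosetProj_homMono_mul_of_ne hΔ σ b C hC, zero_mul]

theorem sum_cosetTensorProj (hΔ : Δ.IsWide) (z : RelTensor (S.subring Δ)) :
    (S.cosetTensorProj hΔ z).sum (fun _ r => r) = mulMap _ z := by
  refine DFunLike.congr_fun (f := (Finsupp.liftAddHom fun _ => AddMonoidHom.id _).comp
    (S.cosetTensorProj hΔ)) (g := mulMap _) (relTensor_hom_ext _ fun r r' => ?_) z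
  rw [AddMonoidHom.comp_apply, cosetTensorProj_tmul, mulMap_tmul]
  refine CrossedProduct.induction S (p := fun r => Finsupp.liftAddHom (fun _ => AddMonoidHom.id _)
    (S.mulRightFinsupp hΔ r' (S.cosetProj hΔ r)) = r * r') r
    (by rw [map_zero, map_zero, map_zero, zero_mul]) (fun ρ a => ?_)
    (fun x y hx hy => by rw [map_add, map_add, map_add, hx, hy, add_mul])
  refine (congrArg (fun x => Finsupp.liftAddHom (fun _ => AddMonoidHom.id _)
    (S.mulRightFinsupp hΔ r' x)) (S.cosetProj_homMono hΔ ρ.2.2 a)).trans ?_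
  rw [mulRightFinsupp_single, Finsupp.liftAddHom_apply_single]
  rfl

/-- A separable extension has families of central elements, indexed by the cosets `σΔ`, which are
equivariant and have sum `1`. -/
theorem exists_cosetFamily (hΔ : Δ.IsWide) (h : IsSeparable (S.subring Δ)) :
    ∃ c : ∀ e, hΔ.Coset → A e,
      (∀ e, (Function.support (c e)).Finite) ∧
      (∀ e C, hΔ.cosetRange C ≠ e → c e C = 0) ∧
      (∀ {d e : Γ} (τ : d ⟶ e), c e (hΔ.coset τ) ∈ Subring.center (A e)) ∧
      (∀ {d e f : Γ} (τ : d ⟶ e) (σ : e ⟶ f),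
        S.α σ (c e (hΔ.coset τ)) = c f (hΔ.coset (τ ≫ σ))) ∧
      ∀ e, ∑ᶠ C, c e C = 1 := by
  obtain ⟨δ, hl, hr, hμ⟩ := h
  -- Both sides equal `δ(b u_σ)`.
  have hs : ∀ {e f : Γ} (σ : e ⟶ f) (b : A f),
      leftAct _ (S.homMono σ b) (δ (S.homMono (𝟙 e) 1)) =
        rightAct _ (S.homMono σ b) (δ (S.homMono (𝟙 f) 1)) := fun σ b => by
    rw [← hl, ← hr, homMono_mul_id, id_mul_homMono, map_one, mul_one, one_mul]
  -- This compares the coefficients at `σ` in the component of the coset `στΔ`. Below, `σ = 𝟙 e`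
  -- gives centrality and `b = 1` gives equivariance.
  have key : ∀ {d e f : Γ} (τ : d ⟶ e) (σ : e ⟶ f) (b : A f),
      b * S.α σ (coeff S ⟨e, e, 𝟙 e⟩ (S.cosetTensorProj hΔ (δ (S.homMono (𝟙 e) 1))
        (hΔ.coset τ))) = coeff S ⟨f, f, 𝟙 f⟩ (S.cosetTensorProj hΔ (δ (S.homMono (𝟙 f) 1))
        (hΔ.coset (τ ≫ σ))) * b := fun {d e f} τ σ b => by
    rw [← coeff_homMono_mul, ← cosetTensorProj_leftAct, hs, cosetTensorProj_rightAct,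
      mulRightFinsupp_apply, coeff_mul_homMono, S.α_id]
  refine ⟨fun e C => coeff S ⟨e, e, 𝟙 e⟩ (S.cosetTensorProj hΔ (δ (S.homMono (𝟙 e) 1)) C),
    fun e => ?_, fun e C hC => ?_, fun {d e} τ => ?_, fun {d e f} τ σ => ?_, fun e => ?_⟩
  · refine (S.cosetTensorProj hΔ (δ (S.homMono (𝟙 e) 1))).hasFiniteSupport.subset fun C hC h => hC ?_
    change coeff S ⟨e, e, 𝟙 e⟩ _ = 0
    rw [h, map_zero]
  · have h1 := hl (S.homMono (𝟙 e) 1) (S.homMono (𝟙 e) 1)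
    rw [id_mul_homMono, one_mul] at h1
    have h2 := S.cosetTensorProj_leftAct_of_ne hΔ (𝟙 e) 1 C hC (δ (S.homMono (𝟙 e) 1))
    rw [← h1] at h2
    change coeff S ⟨e, e, 𝟙 e⟩ _ = 0
    rw [h2, map_zero]
  · rw [Subring.mem_center_iff]
    intro b
    have := key τ (𝟙 e) b
    rwa [S.α_id, Category.comp_id] at this
  · have := key τ σ 1
    rwa [one_mul, mul_one] at this
  · have h1 := congrArg (coeff S ⟨e, e, 𝟙 e⟩)
      ((S.sum_cosetTensorProj hΔ (δ (S.homMono (𝟙 e) 1))).trans (hμ _))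
    rw [coeff_homMono, Finsupp.sum, map_sum] at h1
    rw [← h1]
    refine finsum_eq_sum_of_support_subset _ fun C hC => ?_
    rw [Finset.mem_coe, Finsupp.mem_support_iff]
    intro h
    apply hC
    change coeff S ⟨e, e, 𝟙 e⟩ _ = 0
    rw [h, map_zero]

theorem exists_sum_relTrace {T : ∀ f e : Γ, Set (f ⟶ e)} (hΔ : Δ.IsWide)
    (hT : Δ.IsTransversal T) (h : IsSeparable (S.subring Δ)) (e : Γ) :
    ∃ (F : Finset Γ) (a : ∀ f : Γ, A f),
      (∀ f ∈ F, (hΔ.isotropy f).FiniteIndex ∧ a f ∈ S.fixedCenter Δ f) ∧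
      ∑ f ∈ F, S.relTrace T f e (a f) = 1 := by
  classical
  obtain ⟨c, hfin, hrange, hcenter, hα, hsum⟩ := S.exists_cosetFamily hΔ h
  have hc : ∀ {f : Γ} (τ : f ⟶ e), S.α τ (c f (hΔ.coset (𝟙 f))) = c e (hΔ.coset τ) := fun τ => by
    rw [hα, Category.id_comp]
  -- One object is taken from each `Δ`-component that contains the domain of a coset in the support
  -- of `c e`.
  refine ⟨(hfin e).toFinset.image hΔ.cosetObj, fun f => c f (hΔ.coset (𝟙 f)), fun f hf => ?_, ?_⟩
  · obtain ⟨C, hC, rfl⟩ := Finset.mem_image.1 hf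
    rw [Set.Finite.mem_toFinset] at hC
    obtain ⟨τ, hτ, hτC⟩ := hT.exists_coset_eq hΔ C (e := e) (by
      by_contra h
      exact hC (hrange e C h))
    refine ⟨(hT.finiteIndex_iff hΔ τ).2 ?_, hcenter _, fun σ hσ => ?_⟩
    -- Some `α_τ(a_f)` is nonzero, hence so is `a_f`. By injectivity of each `α_σ`, every
    -- representative from `f` to `e` then gives a distinct coset in the finite support of `c e`.
    · refine Set.Finite.of_finite_image ((hfin e).subset ?_) (hT.injOn_coset hΔ _ _)
      rintro _ ⟨σ, -, rfl⟩
      rw [Function.mem_support, ← hc, Ne, map_eq_zero_iff _ (S.α σ).injective]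
      intro h0
      refine hC ?_
      rw [← hτC, ← hc, h0, map_zero]
    · dsimp only
      rw [hα, Category.id_comp, (hΔ.coset_eq_iff (𝟙 _) σ).2 ⟨σ, hσ, (Category.comp_id σ).symm⟩]
  · rw [← hsum e, finsum_eq_sum _ (hfin e)]
    -- The support is split into the fibres of `cosetObj`; the fibre over `f` consists of the cosets
    -- of those `τ ∈ T f e` at which `c e` is nonzero.
    refine Finset.sum_image' _ fun C hC => ?_
    rw [Set.Finite.mem_toFinset] at hC
    rw [relTrace, finsum_mem_congr rfl fun τ _ => hc τ,
      ← finsum_mem_image (f := c e) (hT.injOn_coset hΔ _ _)]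
    refine finsum_mem_eq_sum_of_inter_support_eq _ ?_
    ext D
    simp only [Set.mem_inter_iff, Finset.coe_filter, Set.Finite.mem_toFinset, Set.mem_ofPred_eq]
    constructor
    · rintro ⟨⟨τ, hτ, rfl⟩, hD⟩
      exact ⟨⟨hD, hΔ.cosetObj_coset_cosetObj C τ⟩, hD⟩
    · rintro ⟨⟨hD, hDC⟩, -⟩
      have hτ := hT.exists_coset_eq hΔ D (e := e) (by
        by_contra h
        exact hD (hrange e D h))
      rw [hDC] at hτ
      exact ⟨hτ, hD⟩

end ObjectCrossedSystem

/-! ### Connectedness and normal subgroupoids -/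

namespace ObjectCrossedSystem

open CrossedProduct RingExt CategoryTheory.Subgroupoid

variable {Γ : Type u} [Groupoid.{v} Γ] {A : Γ → Type w} [∀ e, Ring (A e)]
variable (S : ObjectCrossedSystem Γ A) {Δ : Subgroupoid Γ} {T : ∀ f e : Γ, Set (f ⟶ e)}

/-- By connectedness, the trace condition at one object suffices for separability. -/
theorem isSeparable_of_sum_relTrace_eq_one (hΓ : ∀ e f : Γ, Nonempty (e ⟶ f)) (hΔ : Δ.IsWide)
    (hT : Δ.IsTransversal T) (e : Γ) (F : Finset Γ) (a : ∀ f, A f)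
    (ha : ∀ f ∈ F, (hΔ.isotropy f).FiniteIndex ∧ a f ∈ S.fixedCenter Δ f)
    (h1 : ∑ f ∈ F, S.relTrace T f e (a f) = 1) : IsSeparable (S.subring Δ) := by
  have hfin : ∀ f ∈ F, ∀ e, (T f e).Finite := fun f hf e =>
    (hT.finiteIndex_iff hΔ (hΓ f e).some).1 (ha f hf).1
  refine S.isSeparable_of_sum_relTrace hΔ hT F a hfin (fun f hf => (ha f hf).2) fun e' => ?_
  obtain ⟨σ⟩ := hΓ e e'
  rw [← map_one (S.α σ), ← h1, map_sum]
  exact Finset.sum_congr rfl fun f hf =>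
    (S.α_relTrace hΔ hT (hfin f hf e) (ha f hf).2 σ).symm

/-- Without objects the trace conditions are vacuous and there is no object to start from. -/
theorem isSeparable_of_isEmpty [IsEmpty Γ] : IsSeparable (S.subring Δ) :=
  S.isSeparable_of_central (fun e => isEmptyElim e) (fun {e} => isEmptyElim e)
    fun e => isEmptyElim e

theorem isSeparable_iff_sum_relTrace (hΓ : ∀ e f : Γ, Nonempty (e ⟶ f)) (hΔ : Δ.IsWide)
    (hT : Δ.IsTransversal T) : IsSeparable (S.subring Δ) ↔
      ∀ e : Γ, ∃ (F : Finset Γ) (a : ∀ f : Γ, A f),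
        (∀ f ∈ F, (hΔ.isotropy f).FiniteIndex ∧ a f ∈ S.fixedCenter Δ f) ∧
        ∑ f ∈ F, S.relTrace T f e (a f) = 1 := by
  refine ⟨fun h e => S.exists_sum_relTrace hΔ hT h e, fun h => ?_⟩
  rcases isEmpty_or_nonempty Γ with _ | ⟨⟨e⟩⟩
  · exact S.isSeparable_of_isEmpty
  · obtain ⟨F, a, ha, h1⟩ := h e
    exact S.isSeparable_of_sum_relTrace_eq_one hΓ hΔ hT e F a ha h1

theorem isSeparable_of_relTrace (hΓ : ∀ e f : Γ, Nonempty (e ⟶ f)) (hΔ : Δ.IsWide)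
    (hT : Δ.IsTransversal T) (f : Γ) (a : A f) (ha : a ∈ S.fixedCenter Δ f)
    (hf : (hΔ.isotropy f).FiniteIndex) (h1 : S.relTrace T f f a = 1) :
    IsSeparable (S.subring Δ) := by
  classical
  refine S.isSeparable_of_sum_relTrace_eq_one hΓ hΔ hT f {f} (Function.update 0 f a) ?_ ?_
  · intro g hg
    obtain rfl := Finset.mem_singleton.1 hg
    exact ⟨hf, by rwa [Function.update_self]⟩
  · rw [Finset.sum_singleton, Function.update_self, h1]

theorem α_mem_fixedCenter (hΔ : Δ.IsNormal) {f e : Γ} (σ : f ⟶ e) {a : A f}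
    (ha : a ∈ S.fixedCenter Δ f) : S.α σ a ∈ S.fixedCenter Δ e := by
  refine ⟨S.α_mem_center σ ha.1, fun δ hδ => ?_⟩
  rw [S.α_comp_of_mem_center δ σ ha.1]
  refine S.α_eq_of_isoCoset_eq hΔ.toIsWide ha _ _ ((hΔ.toIsWide.isoCoset_eq_iff _ _).2
    ⟨σ ≫ δ ≫ Groupoid.inv σ, ?_, by simp⟩)
  simpa using hΔ.conj (Groupoid.inv σ) hδ

/-- Precomposition with `σ` matches the cosets from `e` to `e` with those from `f` to `e`, because
`Δ` is normal. -/
theorem relTrace_α (hΔ : Δ.IsNormal) (hT : Δ.IsTransversal T) {f e : Γ} (σ : f ⟶ e) {a : A f}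
    (ha : a ∈ S.fixedCenter Δ f) : S.relTrace T e e (S.α σ a) = S.relTrace T f e a := by
  rw [relTrace, relTrace, ← hT.finsum_mem_comp (precompEquiv e σ) (hΔ.isoCoset_precomp e σ) _
    (S.α_eq_of_isoCoset_eq hΔ.toIsWide ha)]
  exact finsum_mem_congr rfl fun τ _ => S.α_comp_of_mem_center τ σ ha.1

theorem relTrace_sum {ι : Type*} {f e : Γ} (hfin : (T f e).Finite) (s : Finset ι) (a : ι → A f) :
    S.relTrace T f e (∑ i ∈ s, a i) = ∑ i ∈ s, S.relTrace T f e (a i) := by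
  simp only [relTrace, map_sum, finsum_mem_eq_finite_toFinset_sum _ hfin]
  exact Finset.sum_comm

theorem fixedCenter_sum_mem {ι : Type*} {e : Γ} (s : Finset ι) (a : ι → A e)
    (ha : ∀ i ∈ s, a i ∈ S.fixedCenter Δ e) : ∑ i ∈ s, a i ∈ S.fixedCenter Δ e := by
  refine ⟨Subring.sum_mem _ fun i hi => (ha i hi).1, fun σ hσ => ?_⟩
  rw [map_sum]
  exact Finset.sum_congr rfl fun i hi => (ha i hi).2 σ hσ

theorem isSeparable_iff_relTrace_of_isNormal [∀ e, Nontrivial (A e)]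
    (hΓ : ∀ e f : Γ, Nonempty (e ⟶ f)) (hΔ : Δ.IsWide) (hT : Δ.IsTransversal T)
    (hn : Δ.IsNormal) : IsSeparable (S.subring Δ) ↔
      ∀ e : Γ, (hΔ.isotropy e).FiniteIndex ∧
        ∃ a ∈ S.fixedCenter Δ e, S.relTrace T e e a = 1 := by
  constructor
  · intro h e
    obtain ⟨F, a, ha, h1⟩ := S.exists_sum_relTrace hΔ hT h e
    -- An empty sum would give `0 = 1` in the nontrivial ring `A e`; an index in `F` is needed to
    -- obtain finiteness at `e`.
    have hF : F.Nonempty := by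
      rw [Finset.nonempty_iff_ne_empty]
      rintro rfl
      exact zero_ne_one h1
    obtain ⟨f, hf⟩ := hF
    obtain ⟨σ⟩ := hΓ f e
    have hfin : (T e e).Finite :=
      (hT.bijOn_rep (precompEquiv e σ) (hn.isoCoset_precomp e σ)).finite_iff_finite.2
        ((hT.finiteIndex_iff hΔ σ).1 (ha f hf).1)
    -- The witness collects all `a f` at `e`, transporting each along an arbitrary morphism.
    refine ⟨(hT.finiteIndex_iff hΔ (𝟙 e)).2 hfin, ∑ f ∈ F, S.α (hΓ f e).some (a f),
      S.fixedCenter_sum_mem _ _ fun f hf => S.α_mem_fixedCenter hn _ (ha f hf).2, ?_⟩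
    rw [S.relTrace_sum hfin, ← h1]
    exact Finset.sum_congr rfl fun f hf => S.relTrace_α hn hT _ (ha f hf).2
  · intro h
    rcases isEmpty_or_nonempty Γ with _ | ⟨⟨e⟩⟩
    · exact S.isSeparable_of_isEmpty
    · obtain ⟨hf, a, ha, h1⟩ := h e
      exact S.isSeparable_of_relTrace hΓ hΔ hT e a ha hf h1

/-! ### Object twisted groupoid rings -/

section Twisted

variable {B : Type w} [Ring B] {S' : ObjectCrossedSystem Γ (fun _ => B)}

theorem IsTwisted.mem_fixedCenter (hS : S'.IsTwisted) (e : Γ) (b : B) :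
    b ∈ S'.fixedCenter Δ e ↔ b ∈ Subring.center B :=
  ⟨fun h => h.1, fun h => ⟨h, fun σ _ => hS σ b⟩⟩

/-- Each summand of the trace is `b`, and `T f e` has `[Γ(f):Δ(f)]` members whatever `e` is. -/
theorem IsTwisted.relTrace_eq (hS : S'.IsTwisted) (hΓ : ∀ e f : Γ, Nonempty (e ⟶ f))
    (hΔ : Δ.IsWide) (hT : Δ.IsTransversal T) {f : Γ} (e : Γ) (hf : (hΔ.isotropy f).FiniteIndex)
    (b : B) : S'.relTrace T f e b = ((hΔ.isotropy f).index : B) * b := by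
  obtain ⟨σ⟩ := hΓ f e
  have hfin := (hT.finiteIndex_iff hΔ σ).1 hf
  rw [relTrace, finsum_mem_congr rfl fun τ _ => hS τ b, finsum_mem_eq_finite_toFinset_sum _ hfin,
    Finset.sum_const, nsmul_eq_mul, hT.index_eq hΔ σ, Set.ncard_eq_toFinset_card _ hfin]

/-- An integer is invertible if and only if it has a central right inverse. -/
theorem isUnit_natCast_iff (n : ℕ) :
    IsUnit (n : B) ↔ ∃ b ∈ Subring.center B, (n : B) * b = 1 := by
  constructor
  · rintro ⟨u, hu⟩
    refine ⟨(u⁻¹ : Bˣ), Subring.mem_center_iff.2 fun x => ?_, by rw [← hu, Units.mul_inv]⟩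
    have h : Commute (u : B) x := hu ▸ Nat.cast_commute n x
    exact h.units_inv_left.symm
  · rintro ⟨b, -, h⟩
    exact ⟨⟨n, b, h, (Nat.cast_commute n b).symm.trans h⟩, rfl⟩

theorem IsTwisted.isSeparable_iff (hS : S'.IsTwisted) (hΓ : ∀ e f : Γ, Nonempty (e ⟶ f))
    (hΔ : Δ.IsWide) (hT : Δ.IsTransversal T) : IsSeparable (S'.subring Δ) ↔
      ∀ _e : Γ, ∃ (F : Finset Γ) (b : Γ → B),
        (∀ f ∈ F, (hΔ.isotropy f).FiniteIndex ∧ b f ∈ Subring.center B) ∧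
        ∑ f ∈ F, ((hΔ.isotropy f).index : B) * b f = 1 := by
  rw [S'.isSeparable_iff_sum_relTrace hΓ hΔ hT]
  refine forall_congr' fun e => exists_congr fun F => exists_congr fun b => ?_
  simp only [hS.mem_fixedCenter]
  refine and_congr_right fun h => ?_
  rw [Finset.sum_congr rfl fun f hf => hS.relTrace_eq hΓ hΔ hT e (h f hf).1 (b f)]

theorem IsTwisted.isSeparable_iff_of_isNormal [Nontrivial B] (hS : S'.IsTwisted)
    (hΓ : ∀ e f : Γ, Nonempty (e ⟶ f)) (hΔ : Δ.IsWide) (hT : Δ.IsTransversal T)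
    (hn : Δ.IsNormal) : IsSeparable (S'.subring Δ) ↔
      ∀ e : Γ, (hΔ.isotropy e).FiniteIndex ∧ IsUnit ((hΔ.isotropy e).index : B) := by
  rw [S'.isSeparable_iff_relTrace_of_isNormal hΓ hΔ hT hn]
  refine forall_congr' fun e => and_congr_right fun he => ?_
  simp only [hS.mem_fixedCenter, hS.relTrace_eq hΓ hΔ hT e he, isUnit_natCast_iff]

theorem IsTwisted.isSeparable_of_isUnit (hS : S'.IsTwisted) (hΓ : ∀ e f : Γ, Nonempty (e ⟶ f))
    (hΔ : Δ.IsWide) (hT : Δ.IsTransversal T) (f : Γ) (hf : (hΔ.isotropy f).FiniteIndex)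
    (hu : IsUnit ((hΔ.isotropy f).index : B)) : IsSeparable (S'.subring Δ) := by
  obtain ⟨b, hb, h1⟩ := (isUnit_natCast_iff _).1 hu
  exact S'.isSeparable_of_relTrace hΓ hΔ hT f b ((hS.mem_fixedCenter f b).2 hb) hf
    ((hS.relTrace_eq hΓ hΔ hT f hf b).trans h1)

end Twisted

end ObjectCrossedSystem

end

theorem mainTheorem5 {Γ : Type u} [Groupoid.{v} Γ]
    (hΓ : ∀ e f : Γ, Nonempty (e ⟶ f))
    (Δ : Subgroupoid Γ) (hΔ : Δ.IsWide)
    (T : ∀ f e : Γ, Set (f ⟶ e)) (hT : Δ.IsTransversal T) :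
    -- object crossed products
    (∀ (A : Γ → Type w) [∀ e, Ring (A e)] [∀ e, Nontrivial (A e)]
        (S : ObjectCrossedSystem Γ A),
      -- (a)
      (RingExt.IsSeparable (S.subring Δ) ↔
        ∀ e : Γ, ∃ (F : Finset Γ) (a : ∀ f : Γ, A f),
          (∀ f ∈ F, (hΔ.isotropy f).FiniteIndex ∧ a f ∈ S.fixedCenter Δ f) ∧
          ∑ f ∈ F, S.relTrace T f e (a f) = 1) ∧
      -- (b)
      ((∃ (f : Γ) (a : A f), a ∈ S.fixedCenter Δ f ∧ (hΔ.isotropy f).FiniteIndex ∧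
          S.relTrace T f f a = 1) →
        RingExt.IsSeparable (S.subring Δ)) ∧
      -- (c)
      (Δ.IsNormal →
        (RingExt.IsSeparable (S.subring Δ) ↔
          ∀ e : Γ, (hΔ.isotropy e).FiniteIndex ∧
            ∃ a ∈ S.fixedCenter Δ e, S.relTrace T e e a = 1))) ∧
    -- object twisted groupoid rings
    (∀ (B : Type w) [Ring B] [Nontrivial B]
        (S : ObjectCrossedSystem Γ (fun _ => B)), S.IsTwisted →
      -- (d)
      (RingExt.IsSeparable (S.subring Δ) ↔
        ∀ _e : Γ, ∃ (F : Finset Γ) (b : Γ → B),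
          (∀ f ∈ F, (hΔ.isotropy f).FiniteIndex ∧ b f ∈ Subring.center B) ∧
          ∑ f ∈ F, ((hΔ.isotropy f).index : B) * b f = 1) ∧
      -- (e)
      (Δ.IsNormal →
        (RingExt.IsSeparable (S.subring Δ) ↔
          ∀ e : Γ, (hΔ.isotropy e).FiniteIndex ∧
            IsUnit ((hΔ.isotropy e).index : B))) ∧
      -- (f)
      ((∃ f : Γ, (hΔ.isotropy f).FiniteIndex ∧ IsUnit ((hΔ.isotropy f).index : B)) →
        RingExt.IsSeparable (S.subring Δ))) := by
  refine ⟨fun A _ _ S => ⟨S.isSeparable_iff_sum_relTrace hΓ hΔ hT, ?_,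
    S.isSeparable_iff_relTrace_of_isNormal hΓ hΔ hT⟩, fun B _ _ S hS =>
    ⟨hS.isSeparable_iff hΓ hΔ hT, hS.isSeparable_iff_of_isNormal hΓ hΔ hT, ?_⟩⟩
  · rintro ⟨f, a, ha, hf, h1⟩
    exact S.isSeparable_of_relTrace hΓ hΔ hT f a ha hf h1
  · rintro ⟨f, hf, hu⟩
    exact hS.isSeparable_of_isUnit hΓ hΔ hT f hf hu
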